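/- **Setting.** Fix a database schema (relation names of positive arity, every attribute typed by one of two disjoint infinite domains: the rationals, or uninterpreted constants) and a finite set $F$ of denial constraints, i.e. sentences $\forall\bar x.\,\neg[R_1(\bar x_1)\wedge\dots\wedge R_n(\bar x_n)\wedge\varphi(\bar x)]$ with $n>0$, $\bar x_1\cup\dots\cup\bar x_n=\bar x$, and $\varphi$ quantifier-free using only $=,\neq$ (on both domains) and $<,\le,>,\ge$ (on rationals). An instance $I$ is a finite set of facts $R(t)$. A repair of $I$ is a maximal subset of $I$ consistent with $F$. A conflict in $I$ is a set of facts $\{R_1(t_1),\dots,R_n(t_n)\}\subseteq I$ such that for some constraint of $F$ as above a substitution $\rho$ satisfies $\varphi(\rho(\bar x))$ and $\rho(\bar x_i)=t_i$ for all $i$; two facts of $I$ are neighbors if some conflict in $I$ contains both. A priority $\succ$ of $I$ is an acyclic binary relation on $I$ relating only neighbors; it is total if no other priority of $I$ extends it. A repair $I'$ of $I$ is *Pareto optimal* w.r.t. $\succ$ if there are no nonempty $X\subseteq I'$ and nonempty $Y\subseteq I\setminus I'$ such that $y\succ x$ for all $x\in X$, $y\in Y$, and $(I'\setminus X)\cup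 Y$ is consistent. It is *globally optimal* w.r.t. $\succ$ if there are no nonempty $X\subseteq I'$ and $Y\subseteq I\setminus I'$ such that every $x\in X$ has some $y\in Y$ with $y\succ x$, and $(I'\setminus X)\cup Y$ is consistent. It is *common optimal* w.r.t. $\succ$ if it is globally optimal w.r.t. some total priority extending $\succ$. **Algorithms.** (A) *Constructing a repair:* start with $I^o=I$, $J=\varnothing$; while $I^o\ne\varnothing$, choose any $p\in I^o$, remove it from $I^o$, and add it to $J$ if $J\cup\{p\}$ is consistent with $F$; return $J$. (B) *Constructing a common optimal repair:* the same, except that the loop runs while, and $p$ is chosen in, the set $\omega_\succ(I^o)=\{p\in I^o : \nexists q\in I^o.\ q\succ p\}$. (C) *Constructing a Pareto optimal repair:* construct a repair $I'$ by (A); if $I'$ is Pareto optimal w.r.t. $\succ$ (tested by checking that there is no $y\in I\setminus I'$ such that every conflict in $I'\cup\{y\}$ contains some $x$ with $y\succ x$), return $I'$; otherwise return a common optimal repair constructed by (B). **Proposition.** Algorithm (C) is a sound and complete algorithm constructing Pareto optimal repairs, and it works in polynomial time: there is a polynomial $p$, depending only on the schema and $F$, such that for every instance $I$ and every priority $\succ$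 of $I$, with total input size $s$, every run of (C) on $(I,\succ)$, whatever choices are made, halts within $p(s)$ steps, and the instances returned by the runs are exactly the Pareto optimal repairs of $I$ w.r.t. $F$ and $\succ$. Within the same time bound, the runs of (A) produce exactly the repairs of $I$, the test in (C) decides Pareto optimality of repairs of $I$, and the runs of (B) produce exactly the common optimal repairs of $I$ w.r.t. $F$ and $\succ$. -/

import Mathlib

/-! ## Relational databases -/

/-- The two domains: rationals and uninterpreted constants. -/
inductive Domain where
  | num
  | sym

/-- Constants. Uninterpreted constants are identified with their names. -/
inductive Constant where
  | num (q : ℚ)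
  | sym (s : String)

/-- The domain a constant belongs to. -/
def Constant.domain : Constant → Domain
  | .num _ => .num
  | .sym _ => .sym

/-- Length of the notation of a constant (binary numerator and denominator, resp. the name). -/
def Constant.size : Constant → ℕ
  | .num q => 1 + Nat.size q.num.natAbs + Nat.size q.den
  | .sym s => 1 + s.length

/-- A schema: relation names of positive arity, every attribute being typed by a domain.
`signature R` lists the domains of the attributes of `R`. -/
structure Schema where
  Rel : Type
  signature : Rel → List Domain
  arity_pos : ∀ R, signature R ≠ []

/-- A fact `R(t)`. -/
structure DBFact (S : Schema) where
  rel : S.Rel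
  args : List Constant
  typed : args.map Constant.domain = S.signature rel

noncomputable instance (S : Schema) : DecidableEq (DBFact S) := Classical.decEq _

/-- Size of a fact; the relation name counts as one symbol. -/
def DBFact.size {S : Schema} (f : DBFact S) : ℕ := 1 + (f.args.map Constant.size).sum

/-- Instances, viewed as finite sets of facts. -/
abbrev DBInstance (S : Schema) := Finset (DBFact S)

/-! ## Denial constraints -/

/-- Built-in relation symbols. -/
inductive BuiltIn where
  | eq | ne | lt | le | gt | ge

/-- Natural interpretation of the built-in symbols: equality and inequality on all constants,
the order symbols on rationals only. -/
def BuiltIn.Holds : BuiltIn → Constant → Constant → Prop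
  | .eq, a, b => a = b
  | .ne, a, b => a ≠ b
  | .lt, .num a, .num b => a < b
  | .le, .num a, .num b => a ≤ b
  | .gt, .num a, .num b => a > b
  | .ge, .num a, .num b => a ≥ b
  | _, _, _ => False

/-- Whether a built-in symbol is available on a domain. -/
def BuiltIn.AllowedOn : BuiltIn → Domain → Prop
  | .eq, _ => True
  | .ne, _ => True
  | _, d => d = .num

/-- Terms over `n` variables. -/
inductive DBTerm (n : ℕ) where
  | var (v : Fin n)
  | const (c : Constant)

def DBTerm.value {n : ℕ} (ρ : Fin n → Constant) : DBTerm n → Constant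
  | .var v => ρ v
  | .const c => c

def DBTerm.domain {n : ℕ} (dom : Fin n → Domain) : DBTerm n → Domain
  | .var v => dom v
  | .const c => c.domain

/-- Quantifier-free formulas over `n` variables that use built-in relation symbols only. -/
inductive QFFormula (n : ℕ) where
  | verum
  | atom (op : BuiltIn) (s t : DBTerm n)
  | neg (φ : QFFormula n)
  | and (φ ψ : QFFormula n)
  | or (φ ψ : QFFormula n)

def QFFormula.Holds {n : ℕ} (ρ : Fin n → Constant) : QFFormula n → Prop
  | .verum => True
  | .atom op s t => op.Holds (s.value ρ) (t.value ρ)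
  | .neg φ => ¬ φ.Holds ρ
  | .and φ ψ => φ.Holds ρ ∧ ψ.Holds ρ
  | .or φ ψ => φ.Holds ρ ∨ ψ.Holds ρ

def QFFormula.WellTyped {n : ℕ} (dom : Fin n → Domain) : QFFormula n → Prop
  | .verum => True
  | .atom op s t => s.domain dom = t.domain dom ∧ op.AllowedOn (s.domain dom)
  | .neg φ => φ.WellTyped dom
  | .and φ ψ => φ.WellTyped dom ∧ ψ.WellTyped dom
  | .or φ ψ => φ.WellTyped dom ∧ ψ.WellTyped dom

/-- An atom `R(x̄)` over `n` variables. -/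
structure RelAtom (S : Schema) (n : ℕ) where
  rel : S.Rel
  vars : List (Fin n)

/-- The substitution `ρ` turns the atom into the fact `f`. -/
def RelAtom.Matches {S : Schema} {n : ℕ} (ρ : Fin n → Constant) (a : RelAtom S n) (f : DBFact S) :
    Prop :=
  f.rel = a.rel ∧ f.args = a.vars.map ρ

/-- A denial constraint `∀ x̄. ¬ [R₁(x̄₁) ∧ … ∧ Rₘ(x̄ₘ) ∧ φ(x̄)]` with `m > 0` and
`x̄₁ ∪ … ∪ x̄ₘ = x̄`, well-typed. -/
structure DenialConstraint (S : Schema) where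
  nvars : ℕ
  dom : Fin nvars → Domain
  atoms : List (RelAtom S nvars)
  cond : QFFormula nvars
  atoms_ne_nil : atoms ≠ []
  covers : ∀ v, ∃ a ∈ atoms, v ∈ a.vars
  atoms_typed : ∀ a ∈ atoms, a.vars.map dom = S.signature a.rel
  cond_typed : cond.WellTyped dom

/-- Substitutions that respect the domains of the variables. -/
def DenialConstraint.Admissible {S : Schema} (c : DenialConstraint S)
    (ρ : Fin c.nvars → Constant) : Prop :=
  ∀ v, (ρ v).domain = c.dom v

/-- `I ⊨ c`. -/
def DenialConstraint.SatisfiedIn {S : Schema} (c : DenialConstraint S) (I : DBInstance S) : Prop :=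
  ∀ ρ, c.Admissible ρ → ¬ ((∀ a ∈ c.atoms, ∃ f ∈ I, a.Matches ρ f) ∧ c.cond.Holds ρ)

/-- `I` is consistent with the finite set `F` of denial constraints. -/
def Consistent {S : Schema} (F : List (DenialConstraint S)) (I : DBInstance S) : Prop :=
  ∀ c ∈ F, c.SatisfiedIn I

/-- `Rep(I, F)`: the maximal consistent subsets of `I`. -/
def Repairs {S : Schema} (F : List (DenialConstraint S)) (I : DBInstance S) : Set (DBInstance S) :=
  {I' | Maximal (fun J => J ⊆ I ∧ Consistent F J) I'}

/-- `C` is a conflict in `I` w.r.t. `F`. -/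
def IsConflict {S : Schema} (F : List (DenialConstraint S)) (I C : DBInstance S) : Prop :=
  C ⊆ I ∧ ∃ c ∈ F, ∃ ρ, c.Admissible ρ ∧ c.cond.Holds ρ ∧
    ∃ fs : List (DBFact S), List.Forall₂ (fun a f => a.Matches ρ f) c.atoms fs ∧ C = fs.toFinset

/-- Some conflict in `I` contains both facts. -/
def Neighbors {S : Schema} (F : List (DenialConstraint S)) (I : DBInstance S) (x y : DBFact S) : Prop :=
  ∃ C, IsConflict F I C ∧ x ∈ C ∧ y ∈ C

/-! ## Priorities and preferred repairs

`r x y` stands for `x ≻ y`. -/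

/-- Priorities of `I` w.r.t. `F`: acyclic relations that relate only neighboring facts of `I`. -/
structure IsPriority {S : Schema} (F : List (DenialConstraint S)) (I : DBInstance S)
    (r : DBFact S → DBFact S → Prop) : Prop where
  acyclic : ∀ x, ¬ Relation.TransGen r x x
  neighbors : ∀ x y, r x y → x ∈ I ∧ y ∈ I ∧ Neighbors F I x y

/-- Priorities that no other priority extends. -/
def IsTotalPriority {S : Schema} (F : List (DenialConstraint S)) (I : DBInstance S)
    (r : DBFact S → DBFact S → Prop) : Prop :=
  IsPriority F I r ∧ ∀ r' : DBFact S → DBFact S → Prop,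
    IsPriority F I r' → (∀ x y, r x y → r' x y) → r' = r

def ParetoOptimal {S : Schema} (F : List (DenialConstraint S)) (I : DBInstance S)
    (r : DBFact S → DBFact S → Prop) (I' : DBInstance S) : Prop :=
  I' ⊆ I ∧ ¬ ∃ X Y : DBInstance S, X.Nonempty ∧ X ⊆ I' ∧ Y.Nonempty ∧ Y ⊆ I \ I' ∧
    (∀ x ∈ X, ∀ y ∈ Y, r y x) ∧ Consistent F ((I' \ X) ∪ Y)

def GloballyOptimal {S : Schema} (F : List (DenialConstraint S)) (I : DBInstance S)
    (r : DBFact S → DBFact S → Prop) (I' : DBInstance S) : Prop :=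
  I' ⊆ I ∧ ¬ ∃ X Y : DBInstance S, X.Nonempty ∧ X ⊆ I' ∧ Y ⊆ I \ I' ∧
    (∀ x ∈ X, ∃ y ∈ Y, r y x) ∧ Consistent F ((I' \ X) ∪ Y)

def CommonOptimal {S : Schema} (F : List (DenialConstraint S)) (I : DBInstance S)
    (r : DBFact S → DBFact S → Prop) (I' : DBInstance S) : Prop :=
  ∃ r' : DBFact S → DBFact S → Prop, IsTotalPriority F I r' ∧ (∀ x y, r x y → r' x y) ∧
    GloballyOptimal F I r' I'

/-- The Pareto optimal repairs. -/
def ParetoRepairs {S : Schema} (F : List (DenialConstraint S)) (I : DBInstance S)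
    (r : DBFact S → DBFact S → Prop) : Set (DBInstance S) :=
  {I' | I' ∈ Repairs F I ∧ ParetoOptimal F I r I'}

/-- The common optimal repairs. -/
def CommonRepairs {S : Schema} (F : List (DenialConstraint S)) (I : DBInstance S)
    (r : DBFact S → DBFact S → Prop) : Set (DBInstance S) :=
  {I' | I' ∈ Repairs F I ∧ CommonOptimal F I r I'}

/-! ## A nondeterministic programming language with a step count

Programs are syntax trees over linked data (Booleans, constants, facts, pairs, lists), run by an
interpreter with a time budget. Variables are represented by parametric higher-order abstract
syntax: a program is given uniformly in `V`, so it can inspect data only by the instructions below,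
each of which is charged. -/

/-- Data types of the language. -/
inductive Ty where
  | bool
  | const
  | fact
  | prod (σ τ : Ty)
  | list (τ : Ty)

def Ty.denote (S : Schema) : Ty → Type
  | .bool => Bool
  | .const => Constant
  | .fact => DBFact S
  | .prod σ τ => σ.denote S × τ.denote S
  | .list τ => List (τ.denote S)

/-- Program expressions of type `τ` with variables taken from `V`. -/
inductive Prog (S : Schema) (V : Ty → Type) : Ty → Type where
  | var {τ : Ty} (x : V τ) : Prog S V τ
  | bind {σ τ : Ty} (e : Prog S V σ) (k : V σ → Prog S V τ) : Prog S V τ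
  | lit (b : Bool) : Prog S V .bool
  | ite {τ : Ty} (c : Prog S V .bool) (t e : Prog S V τ) : Prog S V τ
  | pair {σ τ : Ty} (a : Prog S V σ) (b : Prog S V τ) : Prog S V (.prod σ τ)
  | fst {σ τ : Ty} (p : Prog S V (.prod σ τ)) : Prog S V σ
  | snd {σ τ : Ty} (p : Prog S V (.prod σ τ)) : Prog S V τ
  | nil {τ : Ty} : Prog S V (.list τ)
  | cons {τ : Ty} (a : Prog S V τ) (l : Prog S V (.list τ)) : Prog S V (.list τ)
  | isNil {τ : Ty} (l : Prog S V (.list τ)) : Prog S V .bool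
  /-- `for x in l do acc := body x acc` -/
  | forIn {σ τ : Ty} (l : Prog S V (.list σ)) (init : Prog S V τ)
      (body : V σ → V τ → Prog S V τ) : Prog S V τ
  /-- `while cond state do state := body state` -/
  | whileDo {τ : Ty} (init : Prog S V τ) (cond : V τ → Prog S V .bool)
      (body : V τ → Prog S V τ) : Prog S V τ
  /-- nondeterministic choice of an element of a list -/
  | choose {τ : Ty} (l : Prog S V (.list τ)) : Prog S V τ
  | constant (c : Constant) : Prog S V .const
  /-- is the fact `f` a fact of the relation `R`? -/
  | relIs (R : S.Rel) (f : Prog S V .fact) : Prog S V .bool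
  /-- the `i`-th component of a fact (counted from `0`) -/
  | arg (i : ℕ) (f : Prog S V .fact) : Prog S V .const
  | cmp (op : BuiltIn) (a b : Prog S V .const) : Prog S V .bool
  | eqFact (f g : Prog S V .fact) : Prog S V .bool

/-- Nondeterministic computations with a clock: from a time budget to the set of outcomes, where
`some (a, k)` is a run that ends with value `a` and `k` unused steps, and `none` is a run that
exceeds the budget or gets stuck. -/
def Comp (α : Type) : Type := ℕ → Set (Option (α × ℕ))

namespace Comp

def ret {α : Type} (a : α) : Comp α := fun b => {some (a, b)}

def fail {α : Type} : Comp α := fun _ => {none}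

/-- Spend `k` steps, then continue as `m`. -/
def spend {α : Type} (k : ℕ) (m : Comp α) : Comp α := fun b => if b < k then {none} else m (b - k)

def andThen {α β : Type} (m : Comp α) (f : α → Comp β) : Comp β := fun b =>
  {o | (none ∈ m b ∧ o = none) ∨ ∃ a b', some (a, b') ∈ m b ∧ o ∈ f a b'}

/-- Pick any element of the list, in time `1 + length`; stuck on the empty list. -/
def choose {α : Type} (l : List α) : Comp α :=
  spend (1 + l.length) fun b => {o | (l = [] ∧ o = none) ∨ ∃ a ∈ l, o = some (a, b)}

/-- A for-loop; every iteration costs one step in addition to its body. -/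
def forLoop {α β : Type} (body : α → β → Comp β) : List α → β → Comp β
  | [], s => ret s
  | a :: l, s => spend 1 (andThen (body a s) (forLoop body l))

/-- The first `n` rounds of a while-loop; every round costs one step in addition to the condition
and the body. -/
def whileRounds {β : Type} (cond : β → Comp Bool) (body : β → Comp β) : ℕ → β → Comp β
  | 0, _ => fail
  | n + 1, s => spend 1 (andThen (cond s) fun t =>
      if t then andThen (body s) (whileRounds cond body n) else ret s)

/-- A while-loop. Every round costs at least one step, so with budget `b` the cut-off after `b + 1`
rounds affects only runs that have exceeded the budget anyway. -/
def whileLoop {β : Type} (cond : β → Comp Bool) (body : β → Comp β) (s : β) : Comp β :=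
  fun b => whileRounds cond body (b + 1) s b

/-- No run exceeds the budget `b` or gets stuck. -/
def HaltsWithin {α : Type} (m : Comp α) (b : ℕ) : Prop := none ∉ m b

/-- The results of the runs that end within the budget `b`. -/
def results {α : Type} (m : Comp α) (b : ℕ) : Set α := {a | ∃ k, some (a, k) ∈ m b}

end Comp

open Classical in
/-- The interpreter. Every instruction costs one step; comparisons cost more, according to the
length of the notation of what is compared. -/
noncomputable def Prog.eval {S : Schema} {τ : Ty} :
    Prog S (Ty.denote S) τ → Comp (Ty.denote S τ)
  | .var x => .spend 1 (.ret x)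
  | .bind e k => .spend 1 (e.eval.andThen fun x => (k x).eval)
  | .lit b => .spend 1 (.ret b)
  | .ite c t e => .spend 1 (c.eval.andThen fun x : Bool => if x then t.eval else e.eval)
  | .pair a b => .spend 1 (a.eval.andThen fun x => b.eval.andThen fun y => .ret (x, y))
  | .fst p => .spend 1 (p.eval.andThen fun x => .ret x.1)
  | .snd p => .spend 1 (p.eval.andThen fun x => .ret x.2)
  | .nil => .spend 1 (.ret [])
  | .cons a l => .spend 1 (a.eval.andThen fun x => l.eval.andThen fun y => .ret (List.cons x y))
  | .isNil l => .spend 1 (l.eval.andThen fun x => .ret (List.isEmpty x))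
  | .forIn l init body => .spend 1 (l.eval.andThen fun x => init.eval.andThen fun s =>
      Comp.forLoop (fun a t => (body a t).eval) x s)
  | .whileDo init cond body => .spend 1 (init.eval.andThen fun s =>
      Comp.whileLoop (fun t => (cond t).eval) (fun t => (body t).eval) s)
  | .choose l => .spend 1 (l.eval.andThen fun x => Comp.choose x)
  | .constant c => .spend 1 (.ret c)
  | .relIs R f => .spend 1 (f.eval.andThen fun x : DBFact S => .ret (decide (x.rel = R)))
  | .arg i f => .spend 1 (f.eval.andThen fun x : DBFact S => .ret (x.args.getD i (.num 0)))
  | .cmp op a b => .spend 1 (a.eval.andThen fun x : Constant => b.eval.andThen fun y : Constant =>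
      .spend ((x.size + y.size) ^ 2) (.ret (decide (op.Holds x y))))
  | .eqFact f g => .spend 1 (f.eval.andThen fun x : DBFact S => g.eval.andThen fun y : DBFact S =>
      .spend (x.size + y.size) (.ret (decide (x = y))))

/-! ## The algorithms -/

namespace Prog

variable {S : Schema} {V : Ty → Type}

def not (a : Prog S V .bool) : Prog S V .bool := ite a (lit false) (lit true)

def and (a b : Prog S V .bool) : Prog S V .bool := ite a b (lit false)

def or (a b : Prog S V .bool) : Prog S V .bool := ite a (lit true) b

/-- Conjunction and disjunction of a fixed list of tests. -/
def all : List (Prog S V .bool) → Prog S V .bool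
  | [] => lit true
  | a :: l => and a (all l)

def any : List (Prog S V .bool) → Prog S V .bool
  | [] => lit false
  | a :: l => or a (any l)

/-- Does some element of the list pass the test? -/
def existsIn {τ : Ty} (l : Prog S V (.list τ)) (test : V τ → Prog S V .bool) : Prog S V .bool :=
  forIn l (lit false) fun x found => ite (var found) (lit true) (test x)

/-- The sublist of the elements that pass the test (in reverse order). -/
def filter {τ : Ty} (l : Prog S V (.list τ)) (test : V τ → Prog S V .bool) : Prog S V (.list τ) :=
  forIn l nil fun x acc => ite (test x) (cons (var x) (var acc)) (var acc)

/-- `x ∈ l` -/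
def mem (x : V .fact) (l : V (.list .fact)) : Prog S V .bool :=
  existsIn (var l) fun y => eqFact (var y) (var x)

/-- `l \ {x}` -/
def remove (x : V .fact) (l : V (.list .fact)) : Prog S V (.list .fact) :=
  filter (var l) fun y => not (eqFact (var y) (var x))

/-- `x ≻ y`, where the priority is given by its list of pairs -/
def dominates (prio : V (.list (.prod .fact .fact))) (x y : V .fact) : Prog S V .bool :=
  existsIn (var prio) fun p => and (eqFact (fst (var p)) (var x)) (eqFact (snd (var p)) (var y))

/-- The occurrences of variables in the atom, each with the component of `f` that it stands for. -/
def occurrences {n : ℕ} (a : RelAtom S n) (f : V .fact) : List (Fin n × Prog S V .const) :=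
  a.vars.zipIdx.map fun v => (v.1, arg v.2 (var f))

/-- The value of a term, where `occ` tells where the values of the variables are found. -/
def term {n : ℕ} (occ : List (Fin n × Prog S V .const)) : DBTerm n → Prog S V .const
  | .var v => (occ.lookup v).getD (constant (.num 0))
  | .const c => constant c

/-- Test of a quantifier-free formula. -/
def formula {n : ℕ} (occ : List (Fin n × Prog S V .const)) : QFFormula n → Prog S V .bool
  | .verum => lit true
  | .atom op s t => cmp op (term occ s) (term occ t)
  | .neg φ => not (formula occ φ)
  | .and φ ψ => and (formula occ φ) (formula occ ψ)
  | .or φ ψ => or (formula occ φ) (formula occ ψ)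

/-- Is the sequence `fs` an instance of the atoms of `c` under one substitution satisfying the
condition of `c`? The relation names are compared, then the values found at any two occurrences of
the same variable, then the condition is evaluated. -/
def isInstance (c : DenialConstraint S) (fs : List (V .fact)) : Prog S V .bool :=
  let occ := (List.zipWith occurrences c.atoms fs).flatten
  and (all (List.zipWith (fun a f => relIs a.rel (var f)) c.atoms fs))
    (and (all (((occ ×ˢ occ).filter fun p => p.1.1 = p.2.1).map fun p => cmp .eq p.1.2 p.2.2))
      (formula occ c.cond))

/-- `n` nested loops over `l`: does some sequence of `n` elements pass the test? -/
def existsTuple (l : V (.list .fact)) :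
    ℕ → (List (V .fact) → Prog S V .bool) → Prog S V .bool
  | 0, test => test []
  | n + 1, test => existsIn (var l) fun f => existsTuple l n fun fs => test (f :: fs)

/-- Does some conflict in `l` pass the test? -/
def existsConflict (F : List (DenialConstraint S)) (l : V (.list .fact))
    (test : List (V .fact) → Prog S V .bool) : Prog S V .bool :=
  any (F.map fun c => existsTuple l c.atoms.length fun fs => and (isInstance c fs) (test fs))

/-- `l ⊨ F` -/
def consistent (F : List (DenialConstraint S)) (l : V (.list .fact)) : Prog S V .bool :=
  not (existsConflict F l fun _ => lit true)

/-- `if J ∪ {x} ⊨ F then J ∪ {x} else J` -/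
def addIfConsistent (F : List (DenialConstraint S)) (x : V .fact) (J : V (.list .fact)) :
    Prog S V (.list .fact) :=
  bind (cons (var x) (var J)) fun K => ite (consistent F K) (var K) (var J)

/-- Construction of a repair: start with `(Iᵒ, J) = (I, ∅)`; while `Iᵒ` is nonempty, choose
`x ∈ Iᵒ`, remove it from `Iᵒ`, and add it to `J` if `J ∪ {x} ⊨ F`; return `J`. -/
def constructRepair (F : List (DenialConstraint S)) (I : V (.list .fact)) :
    Prog S V (.list .fact) :=
  snd (whileDo (pair (var I) nil)
    (fun s => not (isNil (fst (var s))))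
    (fun s => bind (fst (var s)) fun Io => bind (snd (var s)) fun J =>
      bind (choose (var Io)) fun x =>
        pair (remove x Io) (addIfConsistent F x J)))

/-- The winnow operator: the facts of `l` that no fact of `l` dominates. -/
def winnow (prio : V (.list (.prod .fact .fact))) (l : V (.list .fact)) : Prog S V (.list .fact) :=
  filter (var l) fun x => not (existsIn (var l) fun y => dominates prio y x)

/-- Construction of a common optimal repair: as `constructRepair`, but the choice is made among the
undominated facts of `Iᵒ`, as long as there are any. -/
def constructCommonOptimalRepair (F : List (DenialConstraint S)) (I : V (.list .fact))
    (prio : V (.list (.prod .fact .fact))) : Prog S V (.list .fact) :=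
  snd (whileDo (pair (var I) nil)
    (fun s => bind (fst (var s)) fun Io => not (isNil (winnow prio Io)))
    (fun s => bind (fst (var s)) fun Io => bind (snd (var s)) fun J =>
      bind (choose (winnow prio Io)) fun x =>
        pair (remove x Io) (addIfConsistent F x J)))

/-- Test of Pareto optimality of a repair `I'` of `I`: there is no `y ∈ I \ I'` such that every
conflict in `I' ∪ {y}` contains a fact dominated by `y`. -/
def isParetoOptimal (F : List (DenialConstraint S)) (I : V (.list .fact))
    (prio : V (.list (.prod .fact .fact))) (I' : V (.list .fact)) : Prog S V .bool :=
  not (existsIn (var I) fun y => and (not (mem y I'))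
    (bind (cons (var y) (var I')) fun K =>
      not (existsConflict F K fun fs => not (any (fs.map fun x => dominates prio y x)))))

/-- Construction of a Pareto optimal repair: construct a repair, return it if it is Pareto optimal,
and otherwise return a common optimal repair. -/
def constructParetoOptimalRepair (F : List (DenialConstraint S)) (I : V (.list .fact))
    (prio : V (.list (.prod .fact .fact))) : Prog S V (.list .fact) :=
  bind (constructRepair F I) fun I' =>
    ite (isParetoOptimal F I prio I') (var I') (constructCommonOptimalRepair F I prio)

end Prog

/-- Size of the input: an instance and a priority, given by lists of facts and of pairs of facts. -/
def inputSize {S : Schema} (l : List (DBFact S)) (p : List (DBFact S × DBFact S)) : ℕ :=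
  (l.map DBFact.size).sum + (p.map fun q => q.1.size + q.2.size).sum

/-- Every run of the program halts within `b` steps, and the instances (listed by the results) that
the runs produce are exactly those in `A`. -/
def ProducesExactly {S : Schema} (e : Prog S (Ty.denote S) (.list .fact)) (b : ℕ)
    (A : Set (DBInstance S)) : Prop :=
  e.eval.HaltsWithin b ∧
    {J : DBInstance S | ∃ l : List (DBFact S), l ∈ e.eval.results b ∧ l.toFinset = J} = A

/-! ## Specifications of computations -/

/-! Correctness is a statement about greedy runs, the running time is a compositional count, and the
two meet in `Comp.Spec`, which records a step bound together with the exact set of results. The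
number of atoms of each constraint is fixed along with `F`, so the search for a conflict is a fixed
number of nested loops over the facts, hence polynomial; every while-loop discards a fact in each
round.

Algorithms (A) and (B) both perform greedy runs (`GreedyRun`), (A) being the case of the empty
relation. Consistency with denial constraints passes to subsets, so a rejected fact is inconsistent
with the final set too, and each run ends in a repair. Conversely, a repair is reached by choosing
its own facts first (`greedyRun_iff_mem_repairs`).

For (B), the order of choice in a run orients the neighbor relation into a total priority extending
the given one. If some `X` could be exchanged for `Y`, the earliest fact of `Y` would precede all of
`X`, hence be consistent with everything accepted before it, although it was rejected
(`GreedyRun.commonOptimal`). Conversely, let `K` be a repair that is globally optimal for a total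
priority, and let `x` be an undominated remaining fact consistent with the considered part of `K`.
If `x` were not in `K`, one could exchange the facts of `K` that `x` dominates for `x`: totality
leaves no conflict between `x` and a remaining fact. Hence a run can follow `K`
(`greedyRun_of_globallyOptimal`).

For (C), exchanges by a single fact suffice to refute Pareto optimality of a repair
(`paretoOptimal_iff`), which justifies the test. Completeness holds because (A) can produce any
repair and the Pareto optimal ones pass the test; soundness, because common optimality implies
Pareto optimality (`CommonOptimal.paretoOptimal`). -/

namespace Comp

/-- With a budget of at least `c`, every run of `m` halts, uses at most `c` steps, and the results
are exactly the elements of `A`. -/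
def Spec {α : Type} (m : Comp α) (c : ℕ) (A : Set α) : Prop :=
  ∀ b, c ≤ b → none ∉ m b ∧ (∀ a k, some (a, k) ∈ m b → a ∈ A ∧ b ≤ k + c) ∧
    ∀ a ∈ A, ∃ k, some (a, k) ∈ m b

variable {α β : Type}

theorem Spec.mono {m : Comp α} {c d : ℕ} {A : Set α} (h : Spec m c A) (hcd : c ≤ d) :
    Spec m d A := by
  intro b hb
  obtain ⟨h1, h2, h3⟩ := h b (hcd.trans hb)
  exact ⟨h1, fun a k hk => ⟨(h2 a k hk).1, (h2 a k hk).2.trans (by omega)⟩, h3⟩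

theorem Spec.congr {m : Comp α} {c : ℕ} {A B : Set α} (h : Spec m c A) (hAB : A = B) :
    Spec m c B := hAB ▸ h

theorem Spec.haltsWithin {m : Comp α} {c b : ℕ} {A : Set α} (h : Spec m c A) (hb : c ≤ b) :
    m.HaltsWithin b := (h b hb).1

theorem Spec.results_eq {m : Comp α} {c b : ℕ} {A : Set α} (h : Spec m c A) (hb : c ≤ b) :
    m.results b = A := by
  obtain ⟨-, h2, h3⟩ := h b hb
  ext a
  exact ⟨fun ⟨k, hk⟩ => (h2 a k hk).1, fun ha => h3 a ha⟩

/-- At the larger of the two budgets both specifications determine the results. This makes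
`constVal` well defined below. -/
theorem Spec.unique {m : Comp α} {c d : ℕ} {A B : Set α} (h : Spec m c A) (h' : Spec m d B) :
    A = B := by
  rw [← h.results_eq (le_max_left c d), ← h'.results_eq (le_max_right c d)]

theorem spec_ret (a : α) : Spec (ret a) 0 {a} := by
  intro b _
  simp [ret]

theorem Spec.spend {m : Comp α} {c : ℕ} {A : Set α} (k : ℕ) (h : Spec m c A) :
    Spec (spend k m) (k + c) A := by
  intro b hb
  obtain ⟨h1, h2, h3⟩ := h (b - k) (by omega)
  have hk : ¬ b < k := by omega
  simp only [Comp.spend, hk, if_false]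
  exact ⟨h1, fun a j hj => ⟨(h2 a j hj).1, by have := (h2 a j hj).2; omega⟩, h3⟩

/-- After at most `c` of `c + d` steps at least `d` remain, so the continuation can be run on
whatever is left. This is why `Spec` speaks of all budgets from the bound on. -/
theorem Spec.andThen {m : Comp α} {f : α → Comp β} {c d : ℕ} {A : Set α} {B : α → Set β}
    (h : Spec m c A) (hf : ∀ a ∈ A, Spec (f a) d (B a)) :
    Spec (andThen m f) (c + d) {y | ∃ a ∈ A, y ∈ B a} := by
  intro b hb
  obtain ⟨h1, h2, h3⟩ := h b (by omega)
  have key : ∀ a k, some (a, k) ∈ m b → a ∈ A ∧ b ≤ k + c ∧ d ≤ k := fun a k hk =>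
    ⟨(h2 a k hk).1, (h2 a k hk).2, by have := (h2 a k hk).2; omega⟩
  refine ⟨?_, ?_, ?_⟩
  · rintro (⟨h, -⟩ | ⟨a, k, hk, hn⟩)
    · exact h1 h
    · obtain ⟨ha, -, hd⟩ := key a k hk
      exact (hf a ha k hd).1 hn
  · rintro y j (⟨-, h⟩ | ⟨a, k, hk, hn⟩)
    · cases h
    · obtain ⟨ha, hb', hd⟩ := key a k hk
      obtain ⟨hy, hj⟩ := (hf a ha k hd).2.1 y j hn
      exact ⟨⟨a, ha, hy⟩, by omega⟩
  · rintro y ⟨a, ha, hy⟩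
    obtain ⟨k, hk⟩ := h3 a ha
    obtain ⟨j, hj⟩ := (hf a ha k (key a k hk).2.2).2.2 y hy
    exact ⟨j, Or.inr ⟨a, k, hk, hj⟩⟩

theorem Spec.andThen_single {m : Comp α} {f : α → Comp β} {c d : ℕ} {a : α} {B : Set β}
    (h : Spec m c {a}) (hf : Spec (f a) d B) : Spec (Comp.andThen m f) (c + d) B := by
  refine (h.andThen (B := fun _ => B) (d := d) ?_).congr ?_
  · rintro _ rfl
    exact hf
  · ext y
    simp

theorem spec_choose {l : List α} (hl : l ≠ []) : Spec (choose l) (1 + l.length) {a | a ∈ l} := by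
  have : Spec (fun b => {o | (l = [] ∧ o = none) ∨ ∃ a ∈ l, o = some (a, b)} : Comp α) 0
      {a | a ∈ l} := by
    intro b _
    refine ⟨?_, ?_, ?_⟩
    · rintro (⟨h, -⟩ | ⟨a, -, h⟩)
      · exact hl h
      · cases h
    · rintro a k (⟨-, h⟩ | ⟨a', ha, h⟩)
      · cases h
      · cases h
        exact ⟨ha, le_rfl⟩
    · intro a ha
      exact ⟨b, Or.inr ⟨a, ha, rfl⟩⟩
  exact this.spend (1 + l.length)

theorem spec_forLoop_single {body : α → β → Comp β} {c : ℕ} {g : β → α → β} {l : List α}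
    (h : ∀ a ∈ l, ∀ s, Spec (body a s) c {g s a}) (s : β) :
    Spec (forLoop body l s) (l.length * (1 + c)) {l.foldl g s} := by
  induction l generalizing s with
  | nil => exact (spec_ret s).mono (by simp)
  | cons a l ih =>
    have h1 := ih (fun a ha => h a (List.mem_cons_of_mem _ ha)) (g s a)
    exact (((h a List.mem_cons_self s).andThen_single h1).spend 1).mono
      (by rw [List.length_cons]; ring_nf; rfl)

/-- The final states reachable by a while-loop with condition `C` and round `step`. -/
inductive Reaches (C : β → Prop) (step : β → Set β) : β → β → Prop where
  | done {s : β} (h : ¬ C s) : Reaches C step s s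
  | next {s s' t : β} (h : C s) (hs : s' ∈ step s) (ht : Reaches C step s' t) : Reaches C step s t

/-! ### Termination and outcomes of while-loops, by a decreasing measure -/

section While

variable {cond : β → Comp Bool} {body : β → Comp β} {c d : ℕ} {C : β → Prop} {step : β → Set β}
  {Inv : β → Prop} {μ : β → ℕ}

/-- Each round lowers `μ`, so the body runs at most `N` times and the condition once more, which
fits into `N + 1` charges of `1 + c + d`. As `N < n`, the cut-off is not reached. -/
theorem spec_whileRounds
    (hcond : ∀ s, Inv s → Spec (cond s) c {t | t = true ↔ C s})
    (hbody : ∀ s, Inv s → C s → Spec (body s) d (step s))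
    (hstep : ∀ s, Inv s → C s → ∀ s' ∈ step s, Inv s' ∧ μ s' < μ s) (N n : ℕ) (s : β)
    (hs : Inv s) (hN : μ s ≤ N) (hn : N < n) :
    Spec (whileRounds cond body n s) ((N + 1) * (1 + c + d)) {t | Reaches C step s t} := by
  induction n generalizing s N with
  | zero => omega
  | succ n ih =>
    by_cases hC : C s
    · have hc : Spec (cond s) c {true} := (hcond s hs).congr (by ext t; simp [hC])
      obtain rfl | ⟨M, rfl⟩ : N = 0 ∨ ∃ M, N = M + 1 := by
        cases N
        · exact Or.inl rfl
        · exact Or.inr ⟨_, rfl⟩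
      · have hb := hbody s hs hC
        -- A result of the body would lower a measure that is already `0`. The case is not
        -- contradictory, since `Spec` allows a computation without outcomes.
        have hempty : step s = ∅ := by
          ext s'
          simp only [Set.mem_empty_iff_false, iff_false]
          intro h
          have := (hstep s hs hC s' h).2
          omega
        have h2 := hb.andThen (f := whileRounds cond body n) (d := 0) (B := fun _ => ∅)
          (by rw [hempty]; simp)
        have h3 := (hc.andThen_single (f := fun t => if t then
          Comp.andThen (body s) (whileRounds cond body n) else ret s) h2).spend 1
        refine (h3.mono (by ring_nf; omega)).congr ?_
        ext t
        simp only [hempty, Set.mem_empty_iff_false, false_and, exists_false, Set.ofPred_false,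
          Set.mem_ofPred_eq, false_iff]
        intro h
        cases h with
        | done h => exact h hC
        | next _ h _ => simp [hempty] at h
      · have h2 := (hbody s hs hC).andThen (f := whileRounds cond body n)
          (d := (M + 1) * (1 + c + d)) (B := fun s' => {t | Reaches C step s' t}) (fun s' hs' => by
            obtain ⟨hi, hm⟩ := hstep s hs hC s' hs'
            exact ih M s' hi (by omega) (by omega))
        have h3 := (hc.andThen_single (f := fun t => if t then
          Comp.andThen (body s) (whileRounds cond body n) else ret s) h2).spend 1
        refine (h3.mono (by ring_nf; omega)).congr ?_
        ext t
        constructor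
        · rintro ⟨s', hs', ht⟩
          exact .next hC hs' ht
        · rintro (h | ⟨-, h, ht⟩)
          · exact absurd hC h
          · exact ⟨_, h, ht⟩
    · have hc : Spec (cond s) c {false} := (hcond s hs).congr (by ext t; simp [hC])
      have h3 := (hc.andThen_single (f := fun t => if t then
          Comp.andThen (body s) (whileRounds cond body n) else ret s) (spec_ret s)).spend 1
      refine (h3.mono (by ring_nf; omega)).congr ?_
      ext t
      constructor
      · rintro rfl
        exact .done hC
      · rintro (h | ⟨h, -, -⟩)
        · rfl
        · exact absurd h hC

theorem spec_whileLoop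
    (hcond : ∀ s, Inv s → Spec (cond s) c {t | t = true ↔ C s})
    (hbody : ∀ s, Inv s → C s → Spec (body s) d (step s))
    (hstep : ∀ s, Inv s → C s → ∀ s' ∈ step s, Inv s' ∧ μ s' < μ s) (N : ℕ) (s : β)
    (hs : Inv s) (hN : μ s ≤ N) :
    Spec (whileLoop cond body s) ((N + 1) * (1 + c + d)) {t | Reaches C step s t} := by
  intro b hb
  refine spec_whileRounds hcond hbody hstep N (b + 1) s hs hN ?_ b hb
  -- The bound is at least `N + 1`, so a sufficient budget `b` satisfies `N < b + 1`, the number of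
  -- rounds unfolded.
  have : (N + 1) * 1 ≤ (N + 1) * (1 + c + d) := Nat.mul_le_mul_left _ (by omega)
  omega

end While

end Comp

/-! ## Specifications of programs -/

namespace Prog

open Comp

variable {S : Schema} {σ τ : Ty}

/-- The program halts within `c` steps and answers whether `P`. -/
def Decides (e : Prog S (Ty.denote S) .bool) (c : ℕ) (P : Prop) : Prop :=
  Spec (α := Bool) e.eval c {t | t = true ↔ P}

theorem Decides.mono {e : Prog S (Ty.denote S) .bool} {c d : ℕ} {P : Prop} (h : e.Decides c P)
    (hcd : c ≤ d) : e.Decides d P := Spec.mono h hcd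

theorem Decides.congr {e : Prog S (Ty.denote S) .bool} {c : ℕ} {P Q : Prop} (h : e.Decides c P)
    (hPQ : P ↔ Q) : e.Decides c Q := Spec.congr h (by simp [hPQ])

theorem decides_true_iff {e : Prog S (Ty.denote S) .bool} {c : ℕ} {P : Prop} (hP : P) :
    e.Decides c P ↔ Spec (α := Bool) e.eval c {true} := by
  simp [Decides, hP]

theorem decides_false_iff {e : Prog S (Ty.denote S) .bool} {c : ℕ} {P : Prop} (hP : ¬ P) :
    e.Decides c P ↔ Spec (α := Bool) e.eval c {false} := by
  simp [Decides, hP]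

theorem decides_of_spec {e : Prog S (Ty.denote S) .bool} {c : ℕ} {t : Bool}
    (h : Spec (α := Bool) e.eval c {t}) : e.Decides c (t = true) := by
  refine Spec.congr h ?_
  ext u
  cases u <;> cases t <;> simp

theorem Decides.spec {e : Prog S (Ty.denote S) .bool} {c : ℕ} {t : Bool}
    (h : e.Decides c (t = true)) : Spec (α := Bool) e.eval c {t} := by
  refine Spec.congr h ?_
  ext u
  cases u <;> cases t <;> simp

theorem spec_var (x : τ.denote S) : Spec (Prog.var (S := S) x).eval 1 {x} :=
  (spec_ret x).spend 1

theorem spec_bind {e : Prog S (Ty.denote S) σ} {k : σ.denote S → Prog S (Ty.denote S) τ} {c d : ℕ}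
    {A : Set (σ.denote S)} {B : σ.denote S → Set (τ.denote S)} (h : Spec e.eval c A)
    (hk : ∀ x ∈ A, Spec (k x).eval d (B x)) :
    Spec (Prog.bind e k).eval (1 + (c + d)) {y | ∃ a ∈ A, y ∈ B a} :=
  (h.andThen hk).spend 1

theorem spec_bind_single {e : Prog S (Ty.denote S) σ} {k : σ.denote S → Prog S (Ty.denote S) τ}
    {c d : ℕ} {x : σ.denote S} {B : Set (τ.denote S)} (h : Spec e.eval c {x})
    (hk : Spec (k x).eval d B) : Spec (Prog.bind e k).eval (1 + (c + d)) B :=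
  (h.andThen_single hk).spend 1

theorem decides_lit (b : Bool) : (Prog.lit (S := S) b).Decides 1 (b = true) :=
  decides_of_spec ((spec_ret b).spend 1)

theorem spec_ite {b : Prog S (Ty.denote S) .bool} {t e : Prog S (Ty.denote S) τ} {c d : ℕ}
    {P : Prop} {A : Set (τ.denote S)} (h : b.Decides c P) (ht : P → Spec t.eval d A)
    (he : ¬ P → Spec e.eval d A) : Spec (Prog.ite b t e).eval (1 + (c + d)) A := by
  by_cases hP : P
  · exact (((decides_true_iff hP).1 h).andThen_single
      (f := fun x : Bool => if x then t.eval else e.eval) (by simpa using ht hP)).spend 1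
  · exact (((decides_false_iff hP).1 h).andThen_single
      (f := fun x : Bool => if x then t.eval else e.eval) (by simpa using he hP)).spend 1

theorem spec_pair {a : Prog S (Ty.denote S) σ} {b : Prog S (Ty.denote S) τ} {c d : ℕ}
    {x : σ.denote S} {y : τ.denote S} (ha : Spec a.eval c {x}) (hb : Spec b.eval d {y}) :
    Spec (Prog.pair a b).eval (1 + (c + (d + 0))) {((x, y) : σ.denote S × τ.denote S)} :=
  (ha.andThen_single (hb.andThen_single (spec_ret (x, y)))).spend 1

theorem spec_fst {p : Prog S (Ty.denote S) (.prod σ τ)} {c : ℕ} {x : σ.denote S × τ.denote S}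
    (h : Spec (α := σ.denote S × τ.denote S) p.eval c {x}) :
    Spec (Prog.fst p).eval (1 + (c + 0)) {x.1} :=
  (h.andThen_single (spec_ret x.1)).spend 1

theorem spec_snd {p : Prog S (Ty.denote S) (.prod σ τ)} {c : ℕ} {A : Set (σ.denote S × τ.denote S)}
    (h : Spec (α := σ.denote S × τ.denote S) p.eval c A) :
    Spec (Prog.snd p).eval (1 + (c + 0)) {y | ∃ x ∈ A, y = x.2} :=
  (h.andThen (fun x _ => spec_ret x.2)).spend 1

theorem spec_snd_single {p : Prog S (Ty.denote S) (.prod σ τ)} {c : ℕ}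
    {x : σ.denote S × τ.denote S} (h : Spec (α := σ.denote S × τ.denote S) p.eval c {x}) :
    Spec (Prog.snd p).eval (1 + (c + 0)) {x.2} :=
  (h.andThen_single (spec_ret x.2)).spend 1

theorem spec_nil : Spec (α := List (τ.denote S)) (Prog.nil (S := S) (τ := τ)).eval 1 {[]} :=
  (spec_ret []).spend 1

theorem spec_cons {a : Prog S (Ty.denote S) τ} {l : Prog S (Ty.denote S) (.list τ)} {c d : ℕ}
    {x : τ.denote S} {y : List (τ.denote S)} (ha : Spec a.eval c {x})
    (hl : Spec (α := List (τ.denote S)) l.eval d {y}) :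
    Spec (α := List (τ.denote S)) (Prog.cons a l).eval (1 + (c + (d + 0))) {x :: y} :=
  (ha.andThen_single (hl.andThen_single (spec_ret (x :: y)))).spend 1

theorem decides_isNil {l : Prog S (Ty.denote S) (.list τ)} {c : ℕ} {x : List (τ.denote S)}
    (hl : Spec (α := List (τ.denote S)) l.eval c {x}) :
    (Prog.isNil l).Decides (1 + (c + 0)) (x = []) :=
  (decides_of_spec (e := Prog.isNil l) (t := x.isEmpty) ((hl.andThen_single
    (f := fun x : List (τ.denote S) => ret x.isEmpty) (spec_ret x.isEmpty)).spend 1)).congr (by simp)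

theorem spec_forIn {l : Prog S (Ty.denote S) (.list σ)} {init : Prog S (Ty.denote S) τ}
    {body : σ.denote S → τ.denote S → Prog S (Ty.denote S) τ} {c d e : ℕ} {x : List (σ.denote S)}
    {s : τ.denote S} {g : τ.denote S → σ.denote S → τ.denote S}
    (hl : Spec (α := List (σ.denote S)) l.eval c {x}) (hi : Spec init.eval d {s})
    (hb : ∀ a ∈ x, ∀ t, Spec (body a t).eval e {g t a}) :
    Spec (Prog.forIn l init body).eval (1 + (c + (d + x.length * (1 + e)))) {x.foldl g s} :=
  (hl.andThen_single (hi.andThen_single (spec_forLoop_single hb s))).spend 1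

theorem spec_whileDo {init : Prog S (Ty.denote S) τ} {cond : τ.denote S → Prog S (Ty.denote S) .bool}
    {body : τ.denote S → Prog S (Ty.denote S) τ} {a c d : ℕ} {s : τ.denote S}
    {C : τ.denote S → Prop} {step : τ.denote S → Set (τ.denote S)} {Inv : τ.denote S → Prop}
    {μ : τ.denote S → ℕ} (hi : Spec init.eval a {s}) (hcond : ∀ s, Inv s → (cond s).Decides c (C s))
    (hbody : ∀ s, Inv s → C s → Spec (body s).eval d (step s))
    (hstep : ∀ s, Inv s → C s → ∀ s' ∈ step s, Inv s' ∧ μ s' < μ s) (N : ℕ)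
    (hs : Inv s) (hN : μ s ≤ N) :
    Spec (Prog.whileDo init cond body).eval (1 + (a + (N + 1) * (1 + c + d)))
      {t | Reaches C step s t} :=
  (hi.andThen_single (spec_whileLoop hcond hbody hstep N s hs hN)).spend 1

theorem spec_choose {l : Prog S (Ty.denote S) (.list τ)} {c : ℕ} {x : List (τ.denote S)}
    (hl : Spec (α := List (τ.denote S)) l.eval c {x}) (hx : x ≠ []) :
    Spec (Prog.choose l).eval (1 + (c + (1 + x.length))) {a | a ∈ x} :=
  (hl.andThen_single (Comp.spec_choose hx)).spend 1

theorem spec_constant (a : Constant) :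
    Spec (α := Constant) (Prog.constant (S := S) a).eval 1 {a} :=
  (spec_ret a).spend 1

theorem decides_relIs (R : S.Rel) (f : DBFact S) :
    (Prog.relIs R (Prog.var (V := Ty.denote S) (τ := .fact) f)).Decides 2 (f.rel = R) := by
  classical
  have := (((spec_var (S := S) (τ := .fact) f).andThen_single
    (f := fun x : DBFact S => .ret (decide (x.rel = R))) (spec_ret (decide (f.rel = R)))).spend 1)
  refine (decides_of_spec (e := Prog.relIs R (Prog.var (V := Ty.denote S) (τ := .fact) f))
    (c := 2) (t := decide (f.rel = R)) ?_).congr (by simp)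
  exact this

theorem spec_arg (i : ℕ) (f : DBFact S) :
    Spec (α := Constant) (Prog.arg i (Prog.var (V := Ty.denote S) (τ := .fact) f)).eval 2
      {f.args.getD i (.num 0)} :=
  ((spec_var (S := S) (τ := .fact) f).andThen_single
    (f := fun x : DBFact S => ret (x.args.getD i (.num 0))) (spec_ret (f.args.getD i (.num 0)))).spend 1

theorem decides_cmp (op : BuiltIn) {a b : Prog S (Ty.denote S) .const} {c d : ℕ} {x y : Constant}
    (ha : Spec (α := Constant) a.eval c {x}) (hb : Spec (α := Constant) b.eval d {y}) :
    (Prog.cmp op a b).Decides (1 + (c + (d + ((x.size + y.size) ^ 2 + 0)))) (op.Holds x y) := by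
  classical
  refine (decides_of_spec (t := decide (op.Holds x y)) ?_).congr (by simp)
  exact (ha.andThen_single (hb.andThen_single (f := fun y : Constant =>
    .spend ((x.size + y.size) ^ 2) (.ret (decide (op.Holds x y))))
    ((spec_ret (decide (op.Holds x y))).spend _)) (f := fun x : Constant => b.eval.andThen
      fun y : Constant => .spend ((x.size + y.size) ^ 2) (.ret (decide (op.Holds x y))))).spend 1

theorem decides_eqFact {a b : Prog S (Ty.denote S) .fact} {c d : ℕ} {x y : DBFact S}
    (ha : Spec (α := DBFact S) a.eval c {x}) (hb : Spec (α := DBFact S) b.eval d {y}) :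
    (Prog.eqFact a b).Decides (1 + (c + (d + (x.size + y.size + 0)))) (x = y) := by
  refine (decides_of_spec (t := decide (x = y)) ?_).congr (by simp)
  exact (ha.andThen_single (hb.andThen_single (f := fun y : DBFact S =>
    .spend (x.size + y.size) (.ret (decide (x = y))))
    ((spec_ret (decide (x = y))).spend _)) (f := fun x : DBFact S => b.eval.andThen
      fun y : DBFact S => .spend (x.size + y.size) (.ret (decide (x = y))))).spend 1

theorem Decides.not {a : Prog S (Ty.denote S) .bool} {c : ℕ} {P : Prop} (h : a.Decides c P) :
    (Prog.not a).Decides (c + 2) (¬ P) :=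
  (show (Prog.not a).Decides (1 + (c + 1)) (¬ P) from
    spec_ite h (fun hP => (decides_lit false).congr (by simp [hP]))
      (fun hP => (decides_lit true).congr (by simp [hP]))).mono (by omega)

theorem Decides.and {a b : Prog S (Ty.denote S) .bool} {c d : ℕ} {P Q : Prop} (h : a.Decides c P)
    (h' : b.Decides d Q) : (Prog.and a b).Decides (c + d + 2) (P ∧ Q) :=
  (show (Prog.and a b).Decides (1 + (c + (d + 1))) (P ∧ Q) from
    spec_ite h (fun hP => (h'.mono (Nat.le_succ d)).congr (by simp [hP]))
      (fun hP => ((decides_lit false).mono (by omega)).congr (by simp [hP]))).mono (by omega)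

theorem Decides.or {a b : Prog S (Ty.denote S) .bool} {c d : ℕ} {P Q : Prop} (h : a.Decides c P)
    (h' : b.Decides d Q) : (Prog.or a b).Decides (c + d + 2) (P ∨ Q) :=
  (show (Prog.or a b).Decides (1 + (c + (d + 1))) (P ∨ Q) from
    spec_ite h (fun hP => ((decides_lit true).mono (by omega)).congr (by simp [hP]))
      (fun hP => (h'.mono (Nat.le_succ d)).congr (by simp [hP]))).mono (by omega)

theorem decides_all {α : Type*} {f : α → Prog S (Ty.denote S) .bool} {c : ℕ} {P : α → Prop}
    {l : List α} (h : ∀ a ∈ l, (f a).Decides c (P a)) :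
    (Prog.all (l.map f)).Decides (l.length * (c + 2) + 1) (∀ a ∈ l, P a) := by
  induction l with
  | nil => exact ((decides_lit true).mono (by simp)).congr (by simp)
  | cons a l ih =>
    exact (((h a List.mem_cons_self).and
      (ih fun a ha => h a (List.mem_cons_of_mem _ ha))).mono
        (by rw [List.length_cons]; ring_nf; omega)).congr (by simp)

theorem decides_any {α : Type*} {f : α → Prog S (Ty.denote S) .bool} {c : ℕ} {P : α → Prop}
    {l : List α} (h : ∀ a ∈ l, (f a).Decides c (P a)) :
    (Prog.any (l.map f)).Decides (l.length * (c + 2) + 1) (∃ a ∈ l, P a) := by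
  induction l with
  | nil => exact ((decides_lit false).mono (by simp)).congr (by simp)
  | cons a l ih =>
    exact (((h a List.mem_cons_self).or
      (ih fun a ha => h a (List.mem_cons_of_mem _ ha))).mono
        (by rw [List.length_cons]; ring_nf; omega)).congr (by simp)

/-- The loop does not stop at the first success; it folds a disjunction over all of `l`, so its cost
is the length times a uniform bound for the test. -/
theorem decides_existsIn {l : List (τ.denote S)} {test : τ.denote S → Prog S (Ty.denote S) .bool}
    {c : ℕ} {P : τ.denote S → Prop} (h : ∀ x ∈ l, (test x).Decides c (P x)) :
    (Prog.existsIn (Prog.var (V := Ty.denote S) (τ := .list τ) l) test).Decides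
      (3 + l.length * (c + 4)) (∃ x ∈ l, P x) := by
  classical
  have key : Spec (α := Bool) _ _ _ := spec_forIn (τ := .bool) (e := c + 3)
    (g := fun t x => (t || decide (P x) : Bool))
    (body := fun x found => Prog.ite (Prog.var found) (Prog.lit true) (test x))
    (spec_var (S := S) (τ := .list τ) l) (decides_lit (S := S) false).spec (fun x hx t => ?_)
  · refine ((decides_of_spec (e := Prog.existsIn (Prog.var (V := Ty.denote S) (τ := .list τ) l) test)
      key).mono (by ring_nf; omega)).congr ?_
    have : ∀ t : Bool, (l.foldl (fun t x => t || decide (P x)) t = true) ↔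
        t = true ∨ ∃ x ∈ l, P x := by
      clear key h
      induction l with
      | nil => simp
      | cons a l ih =>
        intro t
        rw [List.foldl_cons, ih]
        simp [or_assoc]
    exact (this false).trans (by simp)
  · have hv : (Prog.var (S := S) (V := Ty.denote S) (τ := .bool) t).Decides 1 ((t : Bool) = true) :=
      decides_of_spec (spec_var (S := S) (τ := .bool) t)
    have : (Prog.ite (Prog.var (V := Ty.denote S) (τ := .bool) t) (Prog.lit true) (test x)).Decides
        (1 + (1 + (c + 1))) (((t || decide (P x) : Bool)) = true) :=
      spec_ite hv (fun ht => ((decides_lit true).mono (by omega)).congr (by simp [ht]))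
        (fun ht => ((h x hx).mono (by omega)).congr (by simp [ht]))
    exact (this.mono (by omega)).spec

theorem spec_filter {l : List (τ.denote S)} {test : τ.denote S → Prog S (Ty.denote S) .bool}
    {c : ℕ} {P : τ.denote S → Bool} (h : ∀ x ∈ l, (test x).Decides c (P x = true)) :
    Spec (α := List (τ.denote S))
      (Prog.filter (Prog.var (V := Ty.denote S) (τ := .list τ) l) test).eval
      (3 + l.length * (c + 5)) {(l.filter P).reverse} := by
  have key : Spec (α := List (τ.denote S)) _ _ _ := spec_forIn (τ := .list τ) (e := c + 4)
    (g := fun acc x => (if P x then x :: acc else acc : List (τ.denote S)))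
    (body := fun x acc => Prog.ite (test x) (Prog.cons (Prog.var x) (Prog.var acc)) (Prog.var acc))
    (spec_var (S := S) (τ := .list τ) l) (spec_nil (S := S) (τ := τ)) (fun x hx acc => ?_)
  · refine (key.mono (by ring_nf; omega)).congr ?_
    have : ∀ acc : List (τ.denote S), l.foldl (fun acc x => if P x then x :: acc else acc) acc =
        (l.filter P).reverse ++ acc := by
      clear key h
      induction l with
      | nil => simp
      | cons a l ih =>
        intro acc
        rw [List.foldl_cons, ih, List.filter_cons]
        split_ifs <;> simp
    exact congrArg _ ((this []).trans (List.append_nil _))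
  · refine (spec_ite (d := 3) (h x hx) (fun hP => ?_) fun hP => ?_).mono (by omega)
    · exact (spec_cons (spec_var (S := S) x) (spec_var (S := S) (τ := .list τ) acc)).congr
        (congrArg _ (if_pos hP).symm)
    · exact ((spec_var (S := S) (τ := .list τ) acc).mono (by omega)).congr (by simp [hP])

end Prog

/-! ## Running times of the subroutines -/

/-- The sequence `fs` is an instance of the atoms of `c` violating `c`. -/
def DenialConstraint.IsInstance {S : Schema} (c : DenialConstraint S) (fs : List (DBFact S)) :
    Prop :=
  ∃ ρ, c.Admissible ρ ∧ c.cond.Holds ρ ∧ List.Forall₂ (fun a f => a.Matches ρ f) c.atoms fs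

/-- Some sequence of facts of `K` satisfying `T` violates a constraint of `F`. -/
def ConflictWith {S : Schema} (F : List (DenialConstraint S)) (K : DBInstance S)
    (T : List (DBFact S) → Prop) : Prop :=
  ∃ c ∈ F, ∃ fs : List (DBFact S), (∀ f ∈ fs, f ∈ K) ∧ c.IsInstance fs ∧ T fs

/-- `Consistent` asks for a matching fact for each atom separately. For a fixed substitution, one
such fact per list entry forms the sequence, in which facts may repeat. -/
theorem consistent_iff {S : Schema} {F : List (DenialConstraint S)} {K : DBInstance S} :
    Consistent F K ↔ ¬ ConflictWith F K fun _ => True := by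
  constructor
  · rintro h ⟨c, hc, fs, hfs, ⟨ρ, hρ, hcond, hm⟩, -⟩
    refine h c hc ρ hρ ⟨fun a ha => ?_, hcond⟩
    obtain ⟨hlen, hzip⟩ := List.forall₂_iff_get.1 hm
    obtain ⟨i, hi, rfl⟩ := List.getElem_of_mem ha
    exact ⟨fs[i], hfs _ (List.getElem_mem _), hzip i hi (hlen ▸ hi)⟩
  · rintro h c hc ρ hρ ⟨hm, hcond⟩
    have key : ∀ as : List (RelAtom S c.nvars), (∀ a ∈ as, ∃ f ∈ K, a.Matches ρ f) →
        ∃ fs : List (DBFact S), (∀ f ∈ fs, f ∈ K) ∧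
          List.Forall₂ (fun a f => a.Matches ρ f) as fs := by
      intro as
      induction as with
      | nil => exact fun _ => ⟨[], by simp, .nil⟩
      | cons a as ih =>
        intro has
        obtain ⟨f, hf, hfm⟩ := has a List.mem_cons_self
        obtain ⟨fs, hfs, hfsm⟩ := ih fun a ha => has a (List.mem_cons_of_mem _ ha)
        exact ⟨f :: fs, by simpa [hf] using hfs, .cons hfm hfsm⟩
    obtain ⟨fs, hfs, hfsm⟩ := key c.atoms hm
    exact h ⟨c, hc, fs, hfs, ⟨ρ, hρ, hcond, hfsm⟩, trivial⟩

theorem Constant.size_le_of_getD {S : Schema} (f : DBFact S) (i : ℕ) :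
    (f.args.getD i (.num 0)).size ≤ f.size + 2 := by
  by_cases h : i < f.args.length
  · have h1 : f.args.getD i (.num 0) = f.args[i] := by simp [h]
    rw [h1]
    have h2 : (f.args[i]).size ≤ (f.args.map Constant.size).sum :=
      List.single_le_sum (by simp) _ (List.mem_map_of_mem (List.getElem_mem h))
    unfold DBFact.size
    omega
  · have h1 : f.args.getD i (.num 0) = .num 0 := by
      rw [List.getD_eq_default _ _ (by omega)]
    rw [h1]
    -- Beyond the arity the default constant is returned; its size `2` accounts for the summand in
    -- the bound.
    have : (Constant.num 0).size = 2 := by simp [Constant.size]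
    omega

/-- The list has at most `s` facts, each of size at most `s`. -/
def SizeBounded {S : Schema} (s : ℕ) (l : List (DBFact S)) : Prop :=
  l.length ≤ s ∧ ∀ f ∈ l, f.size ≤ s

/-- The list has at most `s` pairs of facts, each of size at most `s`. -/
def PairsSizeBounded {S : Schema} (s : ℕ) (l : List (DBFact S × DBFact S)) : Prop :=
  l.length ≤ s ∧ ∀ q ∈ l, q.1.size ≤ s ∧ q.2.size ≤ s

theorem SizeBounded.cons {S : Schema} {s : ℕ} {l : List (DBFact S)} (h : SizeBounded s l)
    {x : DBFact S} (hx : x.size ≤ s) : SizeBounded (s + 1) (x :: l) := by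
  refine ⟨by simpa using h.1, fun f hf => ?_⟩
  rcases List.mem_cons.1 hf with rfl | hf
  · omega
  · exact (h.2 f hf).trans (by omega)

theorem List.exists_lookup_eq_some {α β : Type*} [DecidableEq α] {l : List (α × β)} {a : α} {b : β}
    (h : (a, b) ∈ l) : ∃ b', l.lookup a = some b' ∧ (a, b') ∈ l := by
  induction l with
  | nil => simp at h
  | cons p l ih =>
    obtain ⟨a', b'⟩ := p
    by_cases hp : a = a'
    · subst hp
      exact ⟨b', by simp, by simp⟩
    · obtain ⟨b'', h1, h2⟩ := ih (by
        rcases List.mem_cons.1 h with h | h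
        · exact absurd (congrArg Prod.fst h) hp
        · exact h)
      have hp' : (a == a') = false := by simpa using hp
      exact ⟨b'', by simpa only [List.lookup_cons, hp'] using h1, List.mem_cons_of_mem _ h2⟩

theorem List.mem_of_lookup_eq_some {α β : Type*} [DecidableEq α] {l : List (α × β)} {a : α} {b : β}
    (h : l.lookup a = some b) : (a, b) ∈ l := by
  induction l with
  | nil => simp at h
  | cons p l ih =>
    obtain ⟨a', b'⟩ := p
    by_cases hp : a = a'
    · subst hp
      simp only [List.lookup_cons, beq_self_eq_true, Option.some.injEq] at h
      simp [h]
    · have hp' : (a == a') = false := by simpa using hp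
      simp only [List.lookup_cons, hp'] at h
      exact List.mem_cons_of_mem _ (ih h)

namespace Prog

open Comp Polynomial

variable {S : Schema}

theorem decides_eqFact_of_size_le {a b : Prog S (Ty.denote S) .fact} {c d s : ℕ} {x y : DBFact S}
    (ha : Spec (α := DBFact S) a.eval c {x}) (hb : Spec (α := DBFact S) b.eval d {y})
    (hx : x.size ≤ s) (hy : y.size ≤ s) : (Prog.eqFact a b).Decides (1 + c + d + 2 * s) (x = y) :=
  (decides_eqFact ha hb).mono (by omega)

theorem decides_mem {s : ℕ} {x : DBFact S} {l : List (DBFact S)} (hx : x.size ≤ s)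
    (hl : SizeBounded s l) :
    (Prog.mem (S := S) (V := Ty.denote S) x l).Decides (3 + s * (2 * s + 7)) (x ∈ l) := by
  refine ((decides_existsIn (S := S) (τ := .fact) (l := l) (c := 1 + 1 + 1 + 2 * s)
    (P := fun y : DBFact S => y = x) fun y hy => decides_eqFact_of_size_le
      (spec_var (S := S) (τ := .fact) y) (spec_var (S := S) (τ := .fact) x) (hl.2 y hy) hx).mono
        ?_).congr ⟨fun ⟨y, hy, h⟩ => h ▸ hy, fun h => ⟨x, h, rfl⟩⟩
  have : l.length * (1 + 1 + 1 + 2 * s + 4) ≤ s * (1 + 1 + 1 + 2 * s + 4) :=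
    Nat.mul_le_mul_right _ hl.1
  calc _ ≤ 3 + s * (1 + 1 + 1 + 2 * s + 4) := Nat.add_le_add_left this 3
    _ = _ := by ring

theorem spec_remove {s : ℕ} {x : DBFact S} {l : List (DBFact S)} (hx : x.size ≤ s)
    (hl : SizeBounded s l) :
    Spec (α := List (DBFact S)) (Prog.remove (S := S) (V := Ty.denote S) x l).eval
      (3 + s * (2 * s + 10)) {(l.filter fun y => y ≠ x).reverse} := by
  refine (spec_filter (S := S) (τ := .fact) (l := l) (c := 1 + 1 + 1 + 2 * s + 2)
    (P := fun y : DBFact S => decide (y ≠ x)) fun y hy => (decides_eqFact_of_size_le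
      (spec_var (S := S) (τ := .fact) y) (spec_var (S := S) (τ := .fact) x)
        (hl.2 y hy) hx).not.congr (by simp)).mono ?_
  have : l.length * (1 + 1 + 1 + 2 * s + 2 + 5) ≤ s * (1 + 1 + 1 + 2 * s + 2 + 5) :=
    Nat.mul_le_mul_right _ hl.1
  calc _ ≤ 3 + s * (1 + 1 + 1 + 2 * s + 2 + 5) := Nat.add_le_add_left this 3
    _ = _ := by ring

theorem decides_dominates {s : ℕ} {prio : List (DBFact S × DBFact S)} {x y : DBFact S}
    (hp : PairsSizeBounded s prio) (hx : x.size ≤ s) (hy : y.size ≤ s) :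
    (Prog.dominates (S := S) (V := Ty.denote S) prio x y).Decides (3 + s * (4 * s + 14))
      ((x, y) ∈ prio) := by
  refine ((decides_existsIn (S := S) (τ := .prod .fact .fact) (l := prio)
    (c := (1 + 2 + 1 + 2 * s) + (1 + 2 + 1 + 2 * s) + 2)
    (P := fun q : DBFact S × DBFact S => q.1 = x ∧ q.2 = y) fun q hq => Decides.and
      (decides_eqFact_of_size_le (spec_fst (spec_var (S := S) (τ := .prod .fact .fact) q))
        (spec_var (S := S) (τ := .fact) x) (hp.2 q hq).1 hx)
      (decides_eqFact_of_size_le (spec_snd_single (spec_var (S := S) (τ := .prod .fact .fact) q))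
        (spec_var (S := S) (τ := .fact) y) (hp.2 q hq).2 hy)).mono ?_).congr ?_
  · calc _ ≤ 3 + s * ((1 + 2 + 1 + 2 * s) + (1 + 2 + 1 + 2 * s) + 2 + 4) :=
        Nat.add_le_add_left (Nat.mul_le_mul_right _ hp.1) 3
      _ = _ := by ring
  · constructor
    · rintro ⟨q, hq, rfl, rfl⟩
      exact hq
    · exact fun h => ⟨(x, y), h, rfl, rfl⟩

/-! ### Reading a substitution off a sequence of facts -/

/-- The value of a program that has only one result. -/
noncomputable def constVal (e : Prog S (Ty.denote S) .const) : Constant :=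
  @Classical.epsilon Constant ⟨.num 0⟩ fun x => ∃ c, Spec (α := Constant) e.eval c {x}

theorem constVal_eq {e : Prog S (Ty.denote S) .const} {c : ℕ} {x : Constant}
    (h : Spec (α := Constant) e.eval c {x}) : constVal e = x := by
  obtain ⟨d, hd⟩ := @Classical.epsilon_spec_aux Constant ⟨.num 0⟩
    (fun x => ∃ c, Spec (α := Constant) e.eval c {x}) ⟨x, c, h⟩
  exact Set.singleton_eq_singleton_iff.1 (hd.unique h)

/-- The substitution read off from the occurrences of the variables. -/
noncomputable def substOf {n : ℕ} (occ : List (Fin n × Prog S (Ty.denote S) .const)) (v : Fin n) :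
    Constant :=
  constVal ((occ.lookup v).getD (constant (.num 0)))

/-- All occurrences are evaluated in two steps, to constants of size at most `s + 2`. -/
def OccurrencesBounded {n : ℕ} (s : ℕ) (occ : List (Fin n × Prog S (Ty.denote S) .const)) : Prop :=
  ∀ p ∈ occ, Spec (α := Constant) p.2.eval 2 {constVal p.2} ∧ (constVal p.2).size ≤ s + 2

theorem spec_term {n : ℕ} (t : DBTerm n) : ∃ N : ℕ, ∀ (s : ℕ)
    (occ : List (Fin n × Prog S (Ty.denote S) .const)), OccurrencesBounded s occ →
      Spec (α := Constant) (term occ t).eval 2 {t.value (substOf occ)} ∧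
        (t.value (substOf occ)).size ≤ s + N := by
  cases t with
  | const c => exact ⟨c.size, fun s occ _ =>
      ⟨(spec_constant c).mono (by omega), by simp [DBTerm.value]⟩⟩
  | var v =>
    refine ⟨2, fun s occ h => ?_⟩
    simp only [term, DBTerm.value, substOf]
    cases hv : occ.lookup v with
    -- A variable without occurrence takes the default constant, again of size `2`; that all
    -- variables occur is not assumed here.
    | none =>
      have h1 := spec_constant (S := S) (.num 0)
      simp only [Option.getD_none]
      rw [constVal_eq h1]
      exact ⟨h1.mono (by omega), by simp [Constant.size]⟩
    | some e => exact h (v, e) (List.mem_of_lookup_eq_some hv)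

theorem decides_formula {n : ℕ} (φ : QFFormula n) : ∃ p : ℕ[X], ∀ (s : ℕ)
    (occ : List (Fin n × Prog S (Ty.denote S) .const)), OccurrencesBounded s occ →
      (formula occ φ).Decides (p.eval s) (φ.Holds (substOf occ)) := by
  induction φ with
  | verum => exact ⟨1, fun s occ _ => ((decides_lit true).mono (by simp)).congr
      (by simp [QFFormula.Holds])⟩
  | atom op t u =>
    obtain ⟨N, hN⟩ := spec_term (S := S) t
    obtain ⟨M, hM⟩ := spec_term (S := S) u
    -- One step for the instruction and two for each term, besides the squared size of what is
    -- compared.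
    refine ⟨5 + (X + C N + (X + C M)) ^ 2, fun s occ h => ?_⟩
    obtain ⟨h1, h2⟩ := hN s occ h
    obtain ⟨h3, h4⟩ := hM s occ h
    refine (decides_cmp op h1 h3).mono ?_
    have : ((t.value (substOf occ)).size + (u.value (substOf occ)).size) ^ 2 ≤
      (s + N + (s + M)) ^ 2 := Nat.pow_le_pow_left (by omega) 2
    simp only [eval_add, eval_pow, eval_X, eval_C, eval_ofNat]
    omega
  | neg φ ih =>
    obtain ⟨p, hp⟩ := ih
    exact ⟨p + 2, fun s occ h => (hp s occ h).not.mono (by simp)⟩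
  | and φ ψ ih ih' =>
    obtain ⟨p, hp⟩ := ih
    obtain ⟨q, hq⟩ := ih'
    exact ⟨p + q + 2, fun s occ h => ((hp s occ h).and (hq s occ h)).mono (by simp)⟩
  | or φ ψ ih ih' =>
    obtain ⟨p, hp⟩ := ih
    obtain ⟨q, hq⟩ := ih'
    exact ⟨p + q + 2, fun s occ h => ((hp s occ h).or (hq s occ h)).mono (by simp)⟩

theorem constVal_arg (i : ℕ) (f : DBFact S) :
    constVal (arg i (var (V := Ty.denote S) (τ := .fact) f)) = f.args.getD i (.num 0) :=
  constVal_eq (spec_arg i f)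

/-- The occurrences of variables in a sequence of atoms matched against a sequence of facts. -/
def allOccurrences {n : ℕ} (as : List (RelAtom S n)) (fs : List (DBFact S)) :
    List (Fin n × Prog S (Ty.denote S) .const) :=
  (List.zipWith (fun (a : RelAtom S n) (f : DBFact S) =>
    occurrences (V := Ty.denote S) a f) as fs).flatten

theorem mem_allOccurrences_iff {n : ℕ} {as : List (RelAtom S n)} {fs : List (DBFact S)}
    {p : Fin n × Prog S (Ty.denote S) .const} :
    p ∈ allOccurrences as fs ↔
      ∃ a f i, (a, f) ∈ as.zip fs ∧ a.vars[i]? = some p.1 ∧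
        p.2 = arg i (var (V := Ty.denote S) (τ := .fact) f) := by
  have : allOccurrences as fs =
      ((as.zip fs).map fun q => occurrences (V := Ty.denote S) q.1 q.2).flatten := by
    rw [List.zip, List.map_zipWith]
    rfl
  rw [this, List.mem_flatten]
  constructor
  · rintro ⟨l, hl, hp⟩
    obtain ⟨⟨a, f⟩, haf, rfl⟩ := List.mem_map.1 hl
    obtain ⟨⟨v, i⟩, hv, rfl⟩ := List.mem_map.1 hp
    exact ⟨a, f, i, haf, List.mem_zipIdx_iff_getElem?.1 hv, rfl⟩
  · rintro ⟨a, f, i, haf, hv, hp⟩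
    refine ⟨_, List.mem_map_of_mem haf, List.mem_map.2 ⟨(p.1, i), ?_, ?_⟩⟩
    · exact List.mem_zipIdx_iff_getElem?.2 hv
    · exact Prod.ext rfl hp.symm

theorem length_allOccurrences_le {n : ℕ} (as : List (RelAtom S n)) (fs : List (DBFact S)) :
    (allOccurrences as fs).length ≤
      (as.map fun a => a.vars.length).sum := by
  induction as generalizing fs with
  | nil => simp [allOccurrences]
  | cons a as ih =>
    cases fs with
    | nil => simp [allOccurrences]
    | cons f fs =>
      have := ih fs
      rw [allOccurrences] at this ⊢
      rw [List.zipWith_cons_cons, List.flatten_cons, List.length_append, List.map_cons,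
        List.sum_cons]
      have h : (occurrences (V := Ty.denote S) a f).length = a.vars.length := by
        simp [occurrences]
      omega

/-- Once all occurrences of each variable agree, the first one, found by `lookup`, represents them
all, so `substOf` reproduces every component of every fact. Conversely, a matching substitution must
equal `substOf`, because every variable occurs in some atom. -/
theorem isInstance_iff (c : DenialConstraint S) {fs : List (DBFact S)}
    (hfs : fs.length = c.atoms.length) {occ : List (Fin c.nvars × Prog S (Ty.denote S) .const)}
    (hocc : occ = allOccurrences c.atoms fs) :
    ((∀ q ∈ c.atoms.zip fs, q.2.rel = q.1.rel) ∧
      (∀ p ∈ occ, ∀ q ∈ occ, p.1 = q.1 → constVal p.2 = constVal q.2) ∧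
        c.cond.Holds (substOf occ)) ↔ c.IsInstance fs := by
  have hmem : ∀ {a f i v}, (a, f) ∈ c.atoms.zip fs → a.vars[i]? = some v →
      (v, arg i (var (V := Ty.denote S) (τ := .fact) f)) ∈ occ := fun {a f i v} haf hv => by
    rw [hocc]
    exact mem_allOccurrences_iff.2 ⟨a, f, i, haf, hv, rfl⟩
  constructor
  · rintro ⟨hrel, heq, hcond⟩
    have hmatch : ∀ {a f}, (a, f) ∈ c.atoms.zip fs → a.Matches (substOf occ) f := by
      intro a f haf
      have hr := hrel _ haf
      refine ⟨hr, ?_⟩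
      have ha := c.atoms_typed a (List.of_mem_zip haf).1
      have hlen : f.args.length = a.vars.length := by
        have h1 := congrArg List.length f.typed
        have h2 := congrArg List.length ha
        simp only [List.length_map] at h1 h2
        rw [h1, h2, hr]
      refine List.ext_getElem (by simpa using hlen) fun i h1 h2 => ?_
      have hi : i < a.vars.length := by omega
      have hp := hmem haf (List.getElem?_eq_getElem hi)
      obtain ⟨e, he, he'⟩ := List.exists_lookup_eq_some hp
      have h3 := heq _ hp _ he' rfl
      rw [constVal_arg] at h3
      rw [List.getElem_map, substOf, he, Option.getD_some, ← h3]
      simp [h1]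
    refine ⟨substOf occ, fun v => ?_, hcond,
      List.forall₂_iff_zip.2 ⟨hfs.symm, fun haf => hmatch haf⟩⟩
    -- Admissibility is inherited from the typing of the fact matched with an atom that contains
    -- `v`.
    obtain ⟨a, ha, hv⟩ := c.covers v
    obtain ⟨i, hi, rfl⟩ := List.getElem_of_mem ha
    have haf : (c.atoms[i], fs[i]'(hfs ▸ hi)) ∈ c.atoms.zip fs := by
      rw [← List.getElem_zip (h := by simp [hfs, hi])]
      exact List.getElem_mem _
    obtain ⟨hr, hargs⟩ := hmatch haf
    have h1 := (fs[i]'(hfs ▸ hi)).typed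
    rw [hr, ← c.atoms_typed _ ha, hargs, List.map_map] at h1
    exact List.map_inj_left.1 h1 v hv
  · rintro ⟨ρ, hρ, hcond, hm⟩
    have hm' : ∀ {a f}, (a, f) ∈ c.atoms.zip fs → a.Matches ρ f := (List.forall₂_iff_zip.1 hm).2
    have hval : ∀ p ∈ occ, constVal p.2 = ρ p.1 := by
      intro p hp
      rw [hocc] at hp
      obtain ⟨a, f, i, haf, hv, he⟩ := mem_allOccurrences_iff.1 hp
      rw [he, constVal_arg, (hm' haf).2]
      simp [hv]
    have hsubst : substOf occ = ρ := by
      funext v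
      obtain ⟨a, ha, hv⟩ := c.covers v
      obtain ⟨i, hi, rfl⟩ := List.getElem_of_mem ha
      have haf : (c.atoms[i], fs[i]'(hfs ▸ hi)) ∈ c.atoms.zip fs := by
        rw [← List.getElem_zip (h := by simp [hfs, hi])]
        exact List.getElem_mem _
      obtain ⟨j, hj⟩ := List.getElem?_of_mem hv
      obtain ⟨e, he, he'⟩ := List.exists_lookup_eq_some (hmem haf hj)
      rw [substOf, he, Option.getD_some, hval _ he']
    refine ⟨fun q hq => (hm' (a := q.1) (f := q.2) hq).1, fun p hp q hq hpq => ?_, by rwa [hsubst]⟩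
    rw [hval p hp, hval q hq, hpq]

theorem decides_isInstance (c : DenialConstraint S) : ∃ p : ℕ[X], ∀ (s : ℕ)
    (fs : List (DBFact S)), fs.length = c.atoms.length → (∀ f ∈ fs, f.size ≤ s) →
      (isInstance (V := Ty.denote S) c fs).Decides (p.eval s) (c.IsInstance fs) := by
  obtain ⟨p, hp⟩ := decides_formula (S := S) c.cond
  -- `M` bounds the number of occurrences and `M * M` the number of compared pairs; both depend on
  -- `c` only and enter the polynomial as constants.
  set M := (c.atoms.map fun a => a.vars.length).sum with hM
  refine ⟨C (c.atoms.length * (2 + 2) + 1) +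
    ((C (M * M) * (5 + (2 * X + 4) ^ 2 + 2) + 1) + p + 2) + 2, fun s fs hfs hs => ?_⟩
  set occ := allOccurrences c.atoms fs with hocc
  have hb : OccurrencesBounded s occ := by
    intro q hq
    obtain ⟨a, f, i, haf, -, he⟩ := mem_allOccurrences_iff.1 hq
    rw [he, constVal_arg]
    have := hs f (List.of_mem_zip haf).2
    exact ⟨spec_arg i f, (Constant.size_le_of_getD f i).trans (by omega)⟩
  have h1 : (all (List.zipWith (fun a f => relIs a.rel (var (V := Ty.denote S) (τ := .fact) f))
      c.atoms fs)).Decides (c.atoms.length * (2 + 2) + 1)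
        (∀ q ∈ c.atoms.zip fs, q.2.rel = q.1.rel) := by
    have := decides_all (l := c.atoms.zip fs) (c := 2) (P := fun q => q.2.rel = q.1.rel)
      (f := fun q => relIs q.1.rel (var (V := Ty.denote S) (τ := .fact) q.2))
      fun q _ => decides_relIs _ _
    rw [List.zip, List.map_zipWith] at this
    refine this.mono (Nat.add_le_add_right (Nat.mul_le_mul_right _ ?_) _)
    simp
  have h2 : (all (((occ ×ˢ occ).filter fun q => q.1.1 = q.2.1).map
      fun q => cmp .eq q.1.2 q.2.2)).Decides (M * M * (5 + (2 * s + 4) ^ 2 + 2) + 1)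
        (∀ p ∈ occ, ∀ q ∈ occ, p.1 = q.1 → constVal p.2 = constVal q.2) := by
    refine ((decides_all (c := 5 + (2 * s + 4) ^ 2)
      (P := fun q => constVal q.1.2 = constVal q.2.2) fun q hq => ?_).mono ?_).congr ?_
    · obtain ⟨hq1, hq2⟩ := List.mem_product.1 (List.mem_of_mem_filter hq)
      obtain ⟨g1, g2⟩ := hb _ hq1
      obtain ⟨g3, g4⟩ := hb _ hq2
      refine (decides_cmp .eq g1 g3).mono ?_
      have : ((constVal q.1.2).size + (constVal q.2.2).size) ^ 2 ≤ (2 * s + 4) ^ 2 :=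
        Nat.pow_le_pow_left (by omega) 2
      omega
    · refine Nat.add_le_add_right (Nat.mul_le_mul_right _ ?_) _
      refine (List.length_filter_le _ _).trans ?_
      have : occ.length ≤ M := length_allOccurrences_le _ _
      exact (List.length_product occ occ).le.trans (Nat.mul_le_mul this this)
    · constructor
      · intro h p hp q hq hpq
        exact h (p, q) (List.mem_filter.2 ⟨List.mem_product.2 ⟨hp, hq⟩, by simpa using hpq⟩)
      · intro h q hq
        obtain ⟨g1, g2⟩ := List.mem_filter.1 hq
        obtain ⟨hq1, hq2⟩ := List.mem_product.1 g1
        exact h _ hq1 _ hq2 (by simpa using g2)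
  refine ((h1.and (h2.and (hp s occ hb))).mono ?_).congr (isInstance_iff c hfs hocc)
  simp

/-! ### Searching for conflicts by nested loops -/

theorem decides_existsTuple (q : ℕ[X]) (n : ℕ) : ∃ p : ℕ[X], ∀ (s : ℕ) (l : List (DBFact S))
    (test : List (DBFact S) → Prog S (Ty.denote S) .bool) (T : List (DBFact S) → Prop),
      l.length ≤ s → (∀ fs, fs.length = n → (∀ f ∈ fs, f ∈ l) →
        (test fs).Decides (q.eval s) (T fs)) →
      (existsTuple (S := S) (V := Ty.denote S) l n test).Decides (p.eval s)
        (∃ fs : List (DBFact S), fs.length = n ∧ (∀ f ∈ fs, f ∈ l) ∧ T fs) := by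
  induction n with
  | zero =>
    refine ⟨q, fun s l test T _ h => (h [] rfl (by simp)).congr ?_⟩
    constructor
    · exact fun h => ⟨[], rfl, by simp, h⟩
    · rintro ⟨fs, h1, -, h2⟩
      rwa [List.length_eq_zero_iff.1 h1] at h2
  | succ n ih =>
    obtain ⟨p, hp⟩ := ih
    -- One more loop costs a factor of about `s`. The depth `n` is fixed before `s`, so the bound
    -- stays polynomial.
    refine ⟨3 + X * (p + 4), fun s l test T hl h => ?_⟩
    refine ((decides_existsIn (S := S) (τ := .fact) (l := l) (c := p.eval s)
      (P := fun f : DBFact S => ∃ fs : List (DBFact S), fs.length = n ∧ (∀ f ∈ fs, f ∈ l) ∧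
        T (f :: fs)) fun f hf => hp s l (fun fs => test (f :: fs)) (fun fs => T (f :: fs)) hl
          fun fs hn hfs => h (f :: fs) (congrArg (· + 1) hn) ?_).mono ?_).congr ?_
    · intro g hg
      rcases List.mem_cons.1 hg with rfl | hg
      · exact hf
      · exact hfs g hg
    · simp only [eval_add, eval_mul, eval_X, eval_ofNat]
      exact Nat.add_le_add_left (Nat.mul_le_mul_right _ hl) 3
    · constructor
      · rintro ⟨f, hf, fs, hn, hfs, hT⟩
        refine ⟨f :: fs, congrArg (· + 1) hn, fun g hg => ?_, hT⟩
        rcases List.mem_cons.1 hg with rfl | hg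
        · exact hf
        · exact hfs g hg
      · rintro ⟨fs, hn, hfs, hT⟩
        cases fs with
        | nil => simp at hn
        | cons f fs =>
          exact ⟨f, hfs f List.mem_cons_self, fs, by simpa using hn,
            fun g hg => hfs g (List.mem_cons_of_mem _ hg), hT⟩

/-- The test may cost more on longer sequences, hence one polynomial for each length; only the
lengths of the atom lists in `F` matter. -/
theorem decides_existsConflict (F : List (DenialConstraint S)) (q : ℕ → ℕ[X]) :
    ∃ p : ℕ[X], ∀ (s : ℕ) (l : List (DBFact S))
      (test : List (DBFact S) → Prog S (Ty.denote S) .bool) (T : List (DBFact S) → Prop),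
      SizeBounded s l → (∀ fs, (∀ f ∈ fs, f ∈ l) →
        (test fs).Decides ((q fs.length).eval s) (T fs)) →
      (existsConflict (S := S) (V := Ty.denote S) F l test).Decides (p.eval s)
        (ConflictWith F l.toFinset T) := by
  induction F with
  | nil => exact ⟨1, fun s l test T _ _ => ((decides_lit false).mono (by simp)).congr
      (by simp [ConflictWith])⟩
  | cons c F ih =>
    obtain ⟨p, hp⟩ := ih
    obtain ⟨p₁, hp₁⟩ := decides_isInstance c
    obtain ⟨p₂, hp₂⟩ := decides_existsTuple (S := S) (p₁ + q c.atoms.length + 2) c.atoms.length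
    refine ⟨p₂ + p + 2, fun s l test T hl h => ?_⟩
    have h1 := hp₂ s l (fun fs => and (isInstance c fs) (test fs))
      (fun fs => c.IsInstance fs ∧ T fs) hl.1 fun fs hn hfs =>
        ((hp₁ s fs hn fun f hf => hl.2 f (hfs f hf)).and (hn ▸ h fs hfs)).mono (by simp)
    refine ((h1.or (hp s l test T hl h)).mono (by simp)).congr ?_
    constructor
    · rintro (⟨fs, -, hfs, hi, hT⟩ | ⟨c', hc', h⟩)
      · exact ⟨c, List.mem_cons_self, fs, by simpa using hfs, hi, hT⟩
      · exact ⟨c', List.mem_cons_of_mem _ hc', h⟩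
    · rintro ⟨c', hc', fs, hfs, hi, hT⟩
      rcases List.mem_cons.1 hc' with rfl | hc'
      · obtain ⟨ρ, -, -, hm⟩ := id hi
        exact Or.inl ⟨fs, hm.length_eq.symm, by simpa using hfs, hi, hT⟩
      · exact Or.inr ⟨c', hc', fs, hfs, hi, hT⟩

theorem decides_consistent (F : List (DenialConstraint S)) : ∃ p : ℕ[X], ∀ (s : ℕ)
    (l : List (DBFact S)), SizeBounded s l →
      (consistent (S := S) (V := Ty.denote S) F l).Decides (p.eval s)
        (Consistent F l.toFinset) := by
  obtain ⟨p, hp⟩ := decides_existsConflict F fun _ => 1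
  refine ⟨p + 2, fun s l hl => ?_⟩
  exact ((hp s l (fun _ => lit true) (fun _ => True) hl fun fs _ =>
    ((decides_lit true).mono (by simp)).congr (by simp)).not.mono (by simp)).congr
      consistent_iff.symm

open Classical in
/-- The list `J` extended by `x` if this is consistent. -/
noncomputable def addFact (F : List (DenialConstraint S)) (x : DBFact S) (J : List (DBFact S)) :
    List (DBFact S) :=
  if Consistent F (x :: J).toFinset then x :: J else J

theorem spec_addIfConsistent (F : List (DenialConstraint S)) : ∃ p : ℕ[X], ∀ (s : ℕ)
    (x : DBFact S) (J : List (DBFact S)), x.size ≤ s → SizeBounded s J →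
      Spec (α := List (DBFact S)) (addIfConsistent (S := S) (V := Ty.denote S) F x J).eval
        (p.eval s) {addFact F x J} := by
  obtain ⟨p, hp⟩ := decides_consistent F
  -- Consistency is tested on `x :: J`, for which the size bound is `s + 1`.
  refine ⟨p.comp (X + 1) + 6, fun s x J hx hJ => ?_⟩
  have h1 := spec_cons (spec_var (S := S) (τ := .fact) x) (spec_var (S := S) (τ := .list .fact) J)
  refine Spec.mono (spec_bind_single (S := S) (σ := .list .fact) (τ := .list .fact)
    (k := fun K => Prog.ite (consistent F K) (var K) (var J)) (B := {addFact F x J})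
    (d := 1 + (p.eval (s + 1) + 1)) h1
    (spec_ite (hp (s + 1) (x :: J) (hJ.cons hx)) (fun h => ?_) fun h => ?_)) ?_
  · rw [addFact, if_pos h]
    exact spec_var (S := S) (τ := .list .fact) (x :: J)
  · rw [addFact, if_neg h]
    exact spec_var (S := S) (τ := .list .fact) J
  · simp only [eval_add, eval_comp, eval_X, eval_one, eval_ofNat]
    omega

end Prog

/-! ## Greedy construction of repairs -/

section Greedy

variable {S : Schema} {F : List (DenialConstraint S)} {I J K : DBInstance S}
  {r : DBFact S → DBFact S → Prop}

/-! ### Antitonicity of consistency, and maximality tested one fact at a time -/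

theorem ConflictWith.mono {T T' : List (DBFact S) → Prop} (h : ConflictWith F J T) (hJK : J ⊆ K)
    (hT : ∀ fs, T fs → T' fs) : ConflictWith F K T' := by
  obtain ⟨c, hc, fs, hfs, hi, ht⟩ := h
  exact ⟨c, hc, fs, fun f hf => hJK (hfs f hf), hi, hT fs ht⟩

theorem Consistent.mono (h : Consistent F K) (hJK : J ⊆ K) : Consistent F J :=
  consistent_iff.2 fun hc => consistent_iff.1 h (hc.mono hJK fun _ => id)

theorem consistent_empty : Consistent F (∅ : DBInstance S) := by
  refine consistent_iff.2 ?_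
  rintro ⟨c, -, fs, hfs, ⟨ρ, -, -, hm⟩, -⟩
  cases fs with
  | nil => exact c.atoms_ne_nil (List.forall₂_nil_right_iff.1 hm)
  | cons f fs => simpa using hfs f List.mem_cons_self

/-- A properly larger consistent set contains a one-fact extension of `K`, consistent as a subset;
so maximality need only be tested on such extensions. -/
theorem mem_repairs_iff : K ∈ Repairs F I ↔
    K ⊆ I ∧ Consistent F K ∧ ∀ y ∈ I, y ∉ K → ¬ Consistent F (insert y K) := by
  constructor
  · rintro ⟨⟨h1, h2⟩, h3⟩
    refine ⟨h1, h2, fun y hy hyK hc => hyK ?_⟩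
    exact h3 ⟨Finset.insert_subset hy h1, hc⟩ (Finset.subset_insert y K)
      (Finset.mem_insert_self y K)
  · rintro ⟨h1, h2, h3⟩
    refine ⟨⟨h1, h2⟩, ?_⟩
    rintro L ⟨hL1, hL2⟩ hKL y hy
    by_contra hyK
    exact h3 y (hL1 hy) hyK (hL2.mono (Finset.insert_subset hy hKL))

open Classical in
/-- The runs of the greedy construction of a repair in which a fact is never chosen before a fact
dominating it: from the facts `I` still to be considered and the facts `J` already accepted, the
set `K` is obtained. -/
inductive GreedyRun (F : List (DenialConstraint S)) (r : DBFact S → DBFact S → Prop) :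
    DBInstance S → DBInstance S → DBInstance S → Prop where
  | done (J : DBInstance S) : GreedyRun F r ∅ J J
  | step {I J K : DBInstance S} {x : DBFact S} (hx : x ∈ I) (hr : ∀ y ∈ I, ¬ r y x)
      (h : GreedyRun F r (I.erase x) (if Consistent F (insert x J) then insert x J else J) K) :
      GreedyRun F r I J K

/-- A greedy run orders the facts compatibly with the priority, and rejects a fact only if it is
inconsistent with the facts accepted before. -/
theorem GreedyRun.exists_rank (h : GreedyRun F r I J K) (hJ : Consistent F J) :
    Consistent F K ∧ J ⊆ K ∧ K ⊆ J ∪ I ∧ ∃ rk : DBFact S → ℕ, Set.InjOn rk I ∧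
      (∀ x ∈ I, ∀ y ∈ I, x ≠ y → r x y → rk x < rk y) ∧ ∀ y ∈ I, y ∉ K →
        ¬ Consistent F (insert y (J ∪ (K ∩ I).filter fun x => rk x < rk y)) := by
  classical
  induction h with
  | done J => exact ⟨hJ, subset_rfl, by simp, fun _ => 0, by simp, by simp, by simp⟩
  | @step I J K x hx hr h ih =>
    set J' := if Consistent F (insert x J) then insert x J else J with hJ'
    have hJJ' : J ⊆ J' := by
      rw [hJ']
      split_ifs
      · exact Finset.subset_insert x J
      · exact subset_rfl
    have hJ'J : J' ⊆ insert x J := by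
      rw [hJ']
      split_ifs
      · exact subset_rfl
      · exact Finset.subset_insert x J
    have hc' : Consistent F J' := by
      rw [hJ']
      split_ifs with hc
      · exact hc
      · exact hJ
    obtain ⟨h1, h2, h3, rk, h4, h5, h6⟩ := ih hc'
    -- The rank is the position in the run: `x`, chosen now, gets `0`, and later facts are shifted
    -- by one.
    refine ⟨h1, hJJ'.trans h2, fun y hy => ?_, fun z => if z = x then 0 else rk z + 1, ?_, ?_, ?_⟩
    · have := h3 hy
      simp only [Finset.mem_union, Finset.mem_erase] at this
      rcases this with h | ⟨-, h⟩
      · rcases Finset.mem_insert.1 (hJ'J h) with rfl | h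
        · exact Finset.mem_union_right _ hx
        · exact Finset.mem_union_left _ h
      · exact Finset.mem_union_right _ h
    · intro y hy z hz hyz
      by_cases hyx : y = x <;> by_cases hzx : z = x
      · rw [hyx, hzx]
      · simp [hyx, hzx] at hyz
      · simp [hyx, hzx] at hyz
      · simp only [hyx, hzx, if_false, Nat.add_right_cancel_iff] at hyz
        exact h4 (Finset.mem_coe.2 (Finset.mem_erase.2 ⟨hyx, hy⟩))
          (Finset.mem_coe.2 (Finset.mem_erase.2 ⟨hzx, hz⟩)) hyz
    · intro y hy z hz hne hyz
      by_cases hzx : z = x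
      · exact absurd (hzx ▸ hyz) (hr y hy)
      · by_cases hyx : y = x
        · simp [hyx, hzx]
        · simpa [hyx, hzx] using h5 y (Finset.mem_erase.2 ⟨hyx, hy⟩) z
            (Finset.mem_erase.2 ⟨hzx, hz⟩) hne hyz
    · intro y hy hyK hcons
      -- If `y` is the fact chosen now, consistency with `J` would have put it into `J'` and hence
      -- into `K`. For a later `y` the induction hypothesis applies: `x`, if accepted, belongs to
      -- `J'` there and to the facts of smaller rank here.
      by_cases hyx : y = x
      · subst hyx
        have hc : Consistent F (insert y J) :=
          hcons.mono (Finset.insert_subset_insert _ Finset.subset_union_left)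
        rw [if_pos hc] at hJ'
        exact hyK (h2 (hJ' ▸ Finset.mem_insert_self y J))
      · refine h6 y (Finset.mem_erase.2 ⟨hyx, hy⟩) hyK (hcons.mono ?_)
        refine Finset.insert_subset_insert _ fun z hz => ?_
        rw [Finset.mem_union, Finset.mem_filter, Finset.mem_inter] at hz ⊢
        by_cases hzx : z = x
        · subst hzx
          have hzJ' : z ∈ K := by
            rcases hz with hz | hz
            · exact h2 hz
            · exact hz.1.1
          exact Or.inr ⟨⟨hzJ', hx⟩, by simp [hyx]⟩
        · rcases hz with hz | ⟨⟨hzK, hzI⟩, hlt⟩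
          · exact Or.inl ((Finset.mem_insert.1 (hJ'J hz)).resolve_left hzx)
          · exact Or.inr ⟨⟨hzK, Finset.mem_of_mem_erase hzI⟩, by simpa [hzx, hyx] using hlt⟩

theorem GreedyRun.mem_repairs (h : GreedyRun F r I ∅ K) : K ∈ Repairs F I := by
  obtain ⟨h1, -, h3, rk, -, -, h6⟩ := h.exists_rank consistent_empty
  refine mem_repairs_iff.2 ⟨by simpa using h3, h1, fun y hy hyK hc => h6 y hy hyK (hc.mono ?_)⟩
  refine Finset.insert_subset_insert _ fun z hz => ?_
  simp only [Finset.empty_union, Finset.mem_filter, Finset.mem_inter] at hz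
  exact hz.1.1

/-- While the facts `L` remain, the accepted ones are `K \ L`. To steer a run to `K` it is enough to
find in each `L` an undominated fact on which the acceptance test agrees with membership in `K`. -/
theorem GreedyRun.of_forall_exists (h : ∀ L ⊆ I, L.Nonempty → ∃ x ∈ L, (∀ y ∈ L, ¬ r y x) ∧
    (x ∈ K ↔ Consistent F (insert x (K \ L)))) : GreedyRun F r I (K \ I) K := by
  induction I using Finset.strongInduction with
  | H I ih =>
    rcases I.eq_empty_or_nonempty with rfl | hne
    · simpa using GreedyRun.done (F := F) (r := r) K
    · obtain ⟨x, hx, hr, hxK⟩ := h I subset_rfl hne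
      refine .step hx hr ?_
      have h1 := ih (I.erase x) (Finset.erase_ssubset hx) fun L hL =>
        h L (hL.trans (Finset.erase_subset x I))
      convert h1 using 1
      ext z
      split_ifs with hc
      · have := hxK.2 hc
        by_cases hz : z = x <;> simp [hz, this]
      · have := mt hxK.1 hc
        by_cases hz : z = x <;> simp [hz, this, hx]

/-- Under the empty relation any fact may be chosen. Choosing the facts of `K` first, each is
accepted because subsets of `K` are consistent; then all others are rejected by maximality. -/
theorem greedyRun_iff_mem_repairs :
    GreedyRun F (fun _ _ => False) I ∅ K ↔ K ∈ Repairs F I := by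
  refine ⟨GreedyRun.mem_repairs, fun h => ?_⟩
  obtain ⟨h1, h2, h3⟩ := mem_repairs_iff.1 h
  have : GreedyRun F (fun _ _ => False) I (K \ I) K := by
    refine .of_forall_exists fun L hL hne => ?_
    by_cases hLK : ∃ x ∈ L, x ∈ K
    · obtain ⟨x, hxL, hxK⟩ := hLK
      exact ⟨x, hxL, by simp, iff_of_true hxK
        (h2.mono (Finset.insert_subset hxK Finset.sdiff_subset))⟩
    · obtain ⟨x, hx⟩ := hne
      push Not at hLK
      have hKL : K \ L = K := Finset.sdiff_eq_self_of_disjoint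
        (Finset.disjoint_right.2 hLK)
      exact ⟨x, hx, by simp, iff_of_false (hLK x hx) (by rw [hKL]; exact h3 x (hL hx) (hLK x hx))⟩
  rwa [Finset.sdiff_eq_empty_iff_subset.2 h1] at this

/-! ### Acyclic priorities, total priorities and common optimality -/

theorem exists_undominated (hr : ∀ x, ¬ Relation.TransGen r x x) {L : DBInstance S}
    (hL : L.Nonempty) : ∃ x ∈ L, ∀ y ∈ L, ¬ r y x := by
  -- Passing to paths gives a transitive relation: a new element above the old undominated one is
  -- then itself undominated.
  suffices ∃ x ∈ L, ∀ y ∈ L, ¬ Relation.TransGen r y x by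
    obtain ⟨x, hx, h⟩ := this
    exact ⟨x, hx, fun y hy hyx => h y hy (.single hyx)⟩
  induction hL using Finset.Nonempty.cons_induction with
  | singleton a => exact ⟨a, by simp, by simpa using hr a⟩
  | cons a L _ _ ih =>
    obtain ⟨x, hx, h⟩ := ih
    by_cases hax : Relation.TransGen r a x
    · refine ⟨a, by simp, fun y hy hya => ?_⟩
      rcases Finset.mem_cons.1 hy with rfl | hy
      · exact hr y hya
      · exact h y hy (hya.trans hax)
    · refine ⟨x, by simp [hx], fun y hy hyx => ?_⟩
      rcases Finset.mem_cons.1 hy with rfl | hy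
      · exact hax hyx
      · exact h y hy hyx

/-- Two facts of a violating sequence are neighbors. -/
theorem neighbors_of_isInstance {c : DenialConstraint S} (hc : c ∈ F) {fs : List (DBFact S)}
    (hfs : ∀ f ∈ fs, f ∈ I) (hi : c.IsInstance fs) {x y : DBFact S} (hx : x ∈ fs) (hy : y ∈ fs) :
    Neighbors F I x y := by
  obtain ⟨ρ, h1, h2, h3⟩ := hi
  refine ⟨fs.toFinset, ⟨fun f hf => hfs f (by simpa using hf), c, hc, ρ, h1, h2, fs, h3, rfl⟩, ?_, ?_⟩
    <;> simpa

theorem Neighbors.symm {x y : DBFact S} (h : Neighbors F I x y) : Neighbors F I y x := by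
  obtain ⟨C, hC, hx, hy⟩ := h
  exact ⟨C, hC, hy, hx⟩

theorem Neighbors.mem {x y : DBFact S} (h : Neighbors F I x y) : x ∈ I ∧ y ∈ I := by
  obtain ⟨C, hC, hx, hy⟩ := h
  exact ⟨hC.1 hx, hC.1 hy⟩

/-- A relation extended by one pair has no cycle unless a path closes the new pair. -/
theorem transGen_insert {α : Type*} {r : α → α → Prop} {a b x y : α}
    (h : Relation.TransGen (fun u v => r u v ∨ (u = a ∧ v = b)) x y) :
    Relation.TransGen r x y ∨ (Relation.ReflTransGen r x a ∧ Relation.ReflTransGen r b y) := by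
  induction h with
  | single h =>
    rcases h with h | ⟨rfl, rfl⟩
    · exact Or.inl (.single h)
    · exact Or.inr ⟨.refl, .refl⟩
  | tail _ h ih =>
    rcases h with h | ⟨rfl, rfl⟩
    · rcases ih with h' | ⟨h1, h2⟩
      · exact Or.inl (h'.tail h)
      · exact Or.inr ⟨h1, h2.tail h⟩
    · rcases ih with h' | ⟨h1, -⟩
      · exact Or.inr ⟨h'.to_reflTransGen, .refl⟩
      · exact Or.inr ⟨h1, .refl⟩

/-- An unrelated pair of distinct neighbors could be added: in the direction of an existing path
from `y` to `x` if there is one, and otherwise as `x` over `y`. Neither choice closes a cycle,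
contradicting maximality. -/
theorem IsTotalPriority.total (h : IsTotalPriority F I r) {x y : DBFact S}
    (hxy : Neighbors F I x y) (hne : x ≠ y) : r x y ∨ r y x := by
  by_contra! hcon
  obtain ⟨hp, hmax⟩ := h
  by_cases hyx : Relation.TransGen r y x
  · have hnxy : ¬ Relation.ReflTransGen r x y := fun h' => by
      exact hp.acyclic y (hyx.trans_left h')
    have := hmax (fun u v => r u v ∨ (u = y ∧ v = x)) ⟨fun z hz => ?_, ?_⟩ fun _ _ => Or.inl
    · exact hcon.2 (this ▸ Or.inr ⟨rfl, rfl⟩)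
    · rcases transGen_insert hz with h' | ⟨h1, h2⟩
      · exact hp.acyclic z h'
      · exact hnxy (h2.trans h1)
    · rintro u v (h' | ⟨rfl, rfl⟩)
      · exact hp.neighbors u v h'
      · exact ⟨hxy.mem.2, hxy.mem.1, hxy.symm⟩
  · have hnyx : ¬ Relation.ReflTransGen r y x := fun h' => by
      rcases Relation.reflTransGen_iff_eq_or_transGen.1 h' with h' | h'
      · exact hne h'
      · exact hyx h'
    have := hmax (fun u v => r u v ∨ (u = x ∧ v = y)) ⟨fun z hz => ?_, ?_⟩ fun _ _ => Or.inl
    · exact hcon.1 (this ▸ Or.inr ⟨rfl, rfl⟩)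
    · rcases transGen_insert hz with h' | ⟨h1, h2⟩
      · exact hp.acyclic z h'
      · exact hnyx (h2.trans h1)
    · rintro u v (h' | ⟨rfl, rfl⟩)
      · exact hp.neighbors u v h'
      · exact ⟨hxy.mem.1, hxy.mem.2, hxy⟩

/-- The total priority prefers, among neighbors, the one considered earlier in the run; it extends
`r` because dominating facts are considered first. -/
theorem GreedyRun.commonOptimal (hr : IsPriority F I r) (h : GreedyRun F r I ∅ K) :
    CommonOptimal F I r K := by
  obtain ⟨h1, -, h3, rk, h4, h5, h6⟩ := h.exists_rank consistent_empty
  rw [Finset.empty_union] at h3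
  have hacyc : ∀ x y, Relation.TransGen (fun u v => Neighbors F I u v ∧ rk u < rk v) x y →
      rk x < rk y := by
    intro x y hxy
    induction hxy with
    | single h => exact h.2
    | tail _ h ih => exact ih.trans h.2
  refine ⟨fun u v => Neighbors F I u v ∧ rk u < rk v, ⟨⟨fun x hx => ?_, fun x y hxy =>
    ⟨hxy.1.mem.1, hxy.1.mem.2, hxy.1⟩⟩, fun r' hr' hext => ?_⟩, fun x y hxy => ?_, h3, ?_⟩
  · exact lt_irrefl _ (hacyc x x hx)
  · funext x y
    refine propext ⟨fun hxy => ?_, hext x y⟩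
    obtain ⟨hx, hy, hn⟩ := hr'.neighbors x y hxy
    refine ⟨hn, ?_⟩
    -- A pair against the ranks creates a cycle of length two with its reverse; equal ranks mean
    -- equal facts, hence a loop.
    by_contra hlt
    rcases (not_lt.1 hlt).lt_or_eq with hlt | heq
    · exact hr'.acyclic x (.tail (.single hxy) (hext y x ⟨hn.symm, hlt⟩))
    · obtain rfl := h4 hy hx heq
      exact hr'.acyclic y (.single hxy)
  · obtain ⟨hx, hy, hn⟩ := hr.neighbors x y hxy
    refine ⟨hn, h5 x hx y hy (fun he => hr.acyclic y (.single (he ▸ hxy))) hxy⟩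
  · rintro ⟨X, Y, ⟨x₀, hx₀⟩, hXK, hY, hXY, hcons⟩
    obtain ⟨y₁, hy₁, -⟩ := hXY x₀ hx₀
    -- Each fact of `X` comes after some fact of `Y`, hence after `y`. The facts accepted before `y`
    -- thus survive the exchange, and its consistency contradicts the rejection of `y`.
    obtain ⟨y, hy, hmin⟩ := Finset.exists_min_image Y rk ⟨y₁, hy₁⟩
    obtain ⟨hyI, hyK⟩ := Finset.mem_sdiff.1 (hY hy)
    refine h6 y hyI hyK (hcons.mono (Finset.insert_subset (Finset.mem_union_right _ hy) ?_))
    intro z hz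
    simp only [Finset.empty_union, Finset.mem_filter, Finset.mem_inter] at hz
    refine Finset.mem_union_left _ (Finset.mem_sdiff.2 ⟨hz.1.1, fun hzX => ?_⟩)
    obtain ⟨y', hy', -, hlt⟩ := hXY z hzX
    have := hmin y' hy'
    omega

theorem greedyRun_of_globallyOptimal (hr : IsTotalPriority F I r) (hK : K ∈ Repairs F I)
    (hopt : GloballyOptimal F I r K) : GreedyRun F r I ∅ K := by
  classical
  obtain ⟨h1, h2, h3⟩ := mem_repairs_iff.1 hK
  have : GreedyRun F r I (K \ I) K := by
    refine .of_forall_exists fun L hL hne => ?_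
    obtain ⟨x, hx, hmax⟩ := exists_undominated hr.1.acyclic hne
    refine ⟨x, hx, hmax, fun hxK =>
      h2.mono (Finset.insert_subset hxK Finset.sdiff_subset), fun hc => ?_⟩
    by_contra hxK
    -- The forbidden exchange replaces exactly the facts of `K` dominated by `x`. A conflict left
    -- over must contain `x`, since `K` is consistent.
    have hcons : Consistent F ((K \ K.filter (r x)) ∪ {x}) := by
      refine consistent_iff.2 ?_
      rintro ⟨c, hcF, fs, hfs, hi, -⟩
      have hfsI : ∀ f ∈ fs, f ∈ I := fun f hf => by
        rcases Finset.mem_union.1 (hfs f hf) with h | h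
        · exact h1 (Finset.mem_sdiff.1 h).1
        · exact Finset.mem_singleton.1 h ▸ hL hx
      have hxfs : x ∈ fs := by
        by_contra hxfs
        refine consistent_iff.1 h2 ⟨c, hcF, fs, fun f hf => ?_, hi, trivial⟩
        rcases Finset.mem_union.1 (hfs f hf) with h | h
        · exact (Finset.mem_sdiff.1 h).1
        · exact absurd (Finset.mem_singleton.1 h ▸ hf) hxfs
      refine consistent_iff.1 hc ⟨c, hcF, fs, fun f hf => ?_, hi, trivial⟩
      by_cases hfx : f = x
      · exact hfx ▸ Finset.mem_insert_self _ _
      · have hf' := hfs f hf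
        simp only [Finset.mem_union, Finset.mem_sdiff, Finset.mem_filter, Finset.mem_singleton, hfx,
          or_false, not_and] at hf'
        refine Finset.mem_insert_of_mem (Finset.mem_sdiff.2 ⟨hf'.1, fun hfL => ?_⟩)
        -- A fact of the conflict lying in `L` is a neighbor of `x`, hence comparable with it:
        -- either it was removed or it dominates `x`. So the conflict lies within `insert x (K \
        -- L)`.
        rcases hr.total (neighbors_of_isInstance hcF hfsI hi hxfs hf) (Ne.symm hfx) with h | h
        · exact hf'.2 hf'.1 h
        · exact hmax f hfL h
    refine hopt.2 ⟨K.filter (r x), {x}, ?_, Finset.filter_subset _ _, ?_, ?_, hcons⟩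
    · rw [Finset.nonempty_iff_ne_empty]
      intro he
      rw [he, Finset.sdiff_empty, Finset.union_comm, ← Finset.insert_eq] at hcons
      exact h3 x (hL hx) hxK hcons
    · exact Finset.singleton_subset_iff.2 (Finset.mem_sdiff.2 ⟨hL hx, hxK⟩)
    · exact fun z hz => ⟨x, Finset.mem_singleton_self x, (Finset.mem_filter.1 hz).2⟩
  rwa [Finset.sdiff_eq_empty_iff_subset.2 h1] at this

/-- Fewer dominations leave more choices, so a run for a total extension is also a run for the given
priority. -/
theorem GreedyRun.of_le {r' : DBFact S → DBFact S → Prop} (hrr' : ∀ x y, r x y → r' x y)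
    (h : GreedyRun F r' I J K) : GreedyRun F r I J K := by
  induction h with
  | done J => exact .done J
  | step hx hr _ ih => exact .step hx (fun y hy hyx => hr y hy (hrr' y _ hyx)) ih

theorem greedyRun_iff_mem_commonRepairs (hr : IsPriority F I r) :
    GreedyRun F r I ∅ K ↔ K ∈ CommonRepairs F I r := by
  refine ⟨fun h => ⟨h.mem_repairs, h.commonOptimal hr⟩, ?_⟩
  rintro ⟨hK, r', hr', hrr', hopt⟩
  exact (greedyRun_of_globallyOptimal hr' hK hopt).of_le hrr'

/-! ### Pareto optimality and its test -/

theorem CommonOptimal.paretoOptimal (h : CommonOptimal F I r K) : ParetoOptimal F I r K := by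
  obtain ⟨r', -, hrr', hK, hopt⟩ := h
  refine ⟨hK, ?_⟩
  rintro ⟨X, Y, hX, hXK, ⟨y, hy⟩, hY, hXY, hc⟩
  exact hopt ⟨X, Y, hX, hXK, hY, fun x hx => ⟨y, hy, hrr' _ _ (hXY x hx y hy)⟩, hc⟩

/-- A repair is Pareto optimal iff no fact dominates a fact of each of the conflicts that it
causes. -/
theorem paretoOptimal_iff (hr : IsPriority F I r) (hK : K ∈ Repairs F I) :
    ParetoOptimal F I r K ↔ ¬ ∃ y ∈ I, y ∉ K ∧
      ¬ ConflictWith F (insert y K) fun fs => ¬ ∃ x ∈ fs, r y x := by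
  classical
  obtain ⟨h1, h2, h3⟩ := mem_repairs_iff.1 hK
  rw [ParetoOptimal, and_iff_right h1, not_iff_not]
  constructor
  · rintro ⟨X, Y, -, hXK, ⟨y, hy⟩, hY, hXY, hc⟩
    obtain ⟨hyI, hyK⟩ := Finset.mem_sdiff.1 (hY hy)
    refine ⟨y, hyI, hyK, ?_⟩
    rintro ⟨c, hcF, fs, hfs, hi, hT⟩
    -- A conflict in `insert y K` without facts dominated by `y` avoids `X`, so it persists after
    -- the exchange.
    refine consistent_iff.1 hc ⟨c, hcF, fs, fun f hf => ?_, hi, trivial⟩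
    rcases Finset.mem_insert.1 (hfs f hf) with rfl | h
    · exact Finset.mem_union_right _ hy
    · refine Finset.mem_union_left _ (Finset.mem_sdiff.2 ⟨h, fun hfX => hT ⟨f, hf, hXY f hfX y hy⟩⟩)
  · rintro ⟨y, hyI, hyK, hy⟩
    have hyy : ¬ r y y := fun h => hr.acyclic y (.single h)
    -- The exchange removes all facts dominated by `y`. There are some: maximality of `K` gives a
    -- conflict in `insert y K`, and the dominated fact in it is not `y` itself.
    refine ⟨K.filter (r y), {y}, ?_, Finset.filter_subset _ _, Finset.singleton_nonempty y,
      Finset.singleton_subset_iff.2 (Finset.mem_sdiff.2 ⟨hyI, hyK⟩), fun x hx z hz => ?_, ?_⟩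
    · have h4 := h3 y hyI hyK
      rw [consistent_iff, not_not] at h4
      obtain ⟨c, hcF, fs, hfs, hi, -⟩ := h4
      by_contra hemp
      refine hy ⟨c, hcF, fs, hfs, hi, ?_⟩
      rintro ⟨x, hx, hyx⟩
      rcases Finset.mem_insert.1 (hfs x hx) with rfl | h
      · exact hyy hyx
      · exact hemp ⟨x, Finset.mem_filter.2 ⟨h, hyx⟩⟩
    · rw [Finset.mem_singleton.1 hz]
      exact (Finset.mem_filter.1 hx).2
    · refine consistent_iff.2 ?_
      rintro ⟨c, hcF, fs, hfs, hi, -⟩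
      refine hy ⟨c, hcF, fs, fun f hf => ?_, hi, ?_⟩
      · rcases Finset.mem_union.1 (hfs f hf) with h | h
        · exact Finset.mem_insert_of_mem (Finset.mem_sdiff.1 h).1
        · exact Finset.mem_singleton.1 h ▸ Finset.mem_insert_self _ _
      · rintro ⟨x, hx, hyx⟩
        rcases Finset.mem_union.1 (hfs x hx) with h | h
        · obtain ⟨ha, hb⟩ := Finset.mem_sdiff.1 h
          exact hb (Finset.mem_filter.2 ⟨ha, hyx⟩)
        · exact hyy (Finset.mem_singleton.1 h ▸ hyx)

end Greedy

/-! ## The algorithms -/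

namespace Prog

open Comp Polynomial

variable {S : Schema} {F : List (DenialConstraint S)} {r : DBFact S → DBFact S → Prop}

/-- Some fact still to be considered is undominated. -/
def HasUndominated (r : DBFact S → DBFact S → Prop) (s : List (DBFact S) × List (DBFact S)) :
    Prop :=
  ∃ x ∈ s.1, ∀ y ∈ s.1, ¬ r y x

/-- The rounds of the greedy construction of a repair, on lists. -/
def greedyStep (F : List (DenialConstraint S)) (r : DBFact S → DBFact S → Prop)
    (s : List (DBFact S) × List (DBFact S)) : Set (List (DBFact S) × List (DBFact S)) :=
  {s' | ∃ x ∈ s.1, (∀ y ∈ s.1, ¬ r y x) ∧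
    s' = ((s.1.filter fun y => y ≠ x).reverse, addFact F x s.2)}

/-- The two lists of a state together have at most `N` facts, each of size at most `N`. -/
def StateBounded (N : ℕ) (s : List (DBFact S) × List (DBFact S)) : Prop :=
  s.1.length + s.2.length ≤ N ∧ (∀ f ∈ s.1, f.size ≤ N) ∧ ∀ f ∈ s.2, f.size ≤ N

theorem _root_.SizeBounded.stateBounded {N : ℕ} {l : List (DBFact S)} (h : SizeBounded N l) :
    StateBounded N (l, []) := ⟨by simpa using h.1, h.2, by simp⟩

theorem ne_nil_iff_hasUndominated {s : List (DBFact S) × List (DBFact S)} {l : List (DBFact S)}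
    (hl : ∀ x, x ∈ l ↔ x ∈ s.1 ∧ ∀ y ∈ s.1, ¬ r y x) : ¬ l = [] ↔ HasUndominated r s := by
  rw [List.eq_nil_iff_forall_not_mem, not_forall_not]
  exact exists_congr hl

theorem StateBounded.fst {N : ℕ} {s : List (DBFact S) × List (DBFact S)} (h : StateBounded N s) :
    SizeBounded N s.1 := ⟨by have := h.1; omega, h.2.1⟩

theorem StateBounded.snd {N : ℕ} {s : List (DBFact S) × List (DBFact S)} (h : StateBounded N s) :
    SizeBounded N s.2 := ⟨by have := h.1; omega, h.2.2⟩

theorem StateBounded.greedyStep {N : ℕ} {s s' : List (DBFact S) × List (DBFact S)}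
    (h : StateBounded N s) (hs' : s' ∈ greedyStep F r s) :
    StateBounded N s' ∧ s'.1.length < s.1.length := by
  obtain ⟨x, hx, -, rfl⟩ := hs'
  obtain ⟨h1, h2, h3⟩ := h
  -- All copies of `x` are dropped, at least one, and at most one fact is accepted, so the total
  -- length does not grow.
  have hlt : (s.1.filter fun y => y ≠ x).length < s.1.length :=
    List.length_filter_lt_length_iff_exists.2 ⟨x, hx, by simp⟩
  have hlen : (addFact F x s.2).length ≤ s.2.length + 1 := by
    rw [addFact]
    split_ifs <;> simp
  refine ⟨⟨?_, fun f hf => ?_, fun f hf => ?_⟩, by rwa [List.length_reverse]⟩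
  · simp only [List.length_reverse]
    omega
  · exact h2 f (List.mem_of_mem_filter (List.mem_reverse.1 hf))
  · simp only [addFact] at hf
    split_ifs at hf
    · rcases List.mem_cons.1 hf with rfl | hf
      · exact h2 _ hx
      · exact h3 f hf
    · exact h3 f hf

theorem StateBounded.of_reaches {N : ℕ} {s t : List (DBFact S) × List (DBFact S)}
    (h : Reaches (HasUndominated r) (Prog.greedyStep F r) s t) (hs : StateBounded N s) :
    StateBounded N t := by
  induction h with
  | done => exact hs
  | next _ hs' _ ih => exact ih (hs.greedyStep hs').1

/-! ### Runs on lists and runs on sets -/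

theorem toFinset_addFact (x : DBFact S) (J : List (DBFact S)) :
    open Classical in (addFact F x J).toFinset =
      if Consistent F (insert x J.toFinset) then insert x J.toFinset else J.toFinset := by
  rw [addFact, List.toFinset_cons]
  split_ifs <;> simp

theorem toFinset_filter_ne (x : DBFact S) (l : List (DBFact S)) :
    (l.filter fun y => y ≠ x).reverse.toFinset = l.toFinset.erase x := by
  ext y
  simp [and_comm]

/-- By acyclicity, the loop can stop for lack of undominated facts only when no facts remain. -/
theorem greedyRun_of_reaches (hr : ∀ x, ¬ Relation.TransGen r x x)
    {s t : List (DBFact S) × List (DBFact S)}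
    (h : Reaches (HasUndominated r) (greedyStep F r) s t) :
    GreedyRun F r s.1.toFinset s.2.toFinset t.2.toFinset := by
  induction h with
  | @done s h =>
    have : s.1.toFinset = ∅ := by
      by_contra hne
      obtain ⟨x, hx, hmax⟩ := exists_undominated hr (Finset.nonempty_iff_ne_empty.2 hne)
      exact h ⟨x, by simpa using hx, fun y hy => hmax y (by simpa using hy)⟩
    rw [this]
    exact .done _
  | next _ hs _ ih =>
    obtain ⟨x, hx, hmax, rfl⟩ := hs
    refine .step (x := x) (by simpa using hx) (fun y hy => hmax y (by simpa using hy)) ?_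
    rwa [toFinset_filter_ne, toFinset_addFact] at ih

theorem exists_reaches_of_greedyRun {I J K : DBInstance S} (h : GreedyRun F r I J K)
    (s : List (DBFact S) × List (DBFact S)) (h1 : s.1.toFinset = I) (h2 : s.2.toFinset = J) :
    ∃ t, Reaches (HasUndominated r) (greedyStep F r) s t ∧ t.2.toFinset = K := by
  induction h generalizing s with
  | done J =>
    refine ⟨s, .done ?_, h2⟩
    rintro ⟨x, hx, -⟩
    rw [(List.toFinset_eq_empty_iff _).1 h1] at hx
    simp at hx
  | @step I J K x hx hmax _ ih =>
    subst h1 h2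
    have hx' : x ∈ s.1 := by simpa using hx
    have hmax' : ∀ y ∈ s.1, ¬ r y x := fun y hy => hmax y (by simpa using hy)
    obtain ⟨t, ht, htK⟩ := ih ((s.1.filter fun y => y ≠ x).reverse, addFact F x s.2)
      (toFinset_filter_ne x s.1) (toFinset_addFact x s.2)
    exact ⟨t, .next ⟨x, hx', hmax'⟩ ⟨x, hx', hmax', rfl⟩ ht, htK⟩

theorem image_reaches (hr : ∀ x, ¬ Relation.TransGen r x x) (inst : List (DBFact S)) :
    {J : DBInstance S | ∃ l : List (DBFact S),
      (∃ t, Reaches (HasUndominated r) (greedyStep F r) (inst, []) t ∧ l = t.2) ∧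
        l.toFinset = J} = {K | GreedyRun F r inst.toFinset ∅ K} := by
  ext K
  constructor
  · rintro ⟨_, ⟨t, ht, rfl⟩, rfl⟩
    exact greedyRun_of_reaches hr ht
  · intro h
    obtain ⟨t, ht, htK⟩ := exists_reaches_of_greedyRun h (inst, []) rfl rfl
    exact ⟨t.2, ⟨t, ht, rfl⟩, htK⟩

/-- A round of the construction of a repair, given how the candidates are computed. -/
theorem spec_round (F : List (DenialConstraint S)) (q : ℕ[X]) : ∃ p : ℕ[X], ∀ (N : ℕ)
    (r : DBFact S → DBFact S → Prop) (s : List (DBFact S) × List (DBFact S))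
    (cand : List (DBFact S) → Prog S (Ty.denote S) (.list .fact)) (l : List (DBFact S)),
      StateBounded N s → Spec (α := List (DBFact S)) (cand s.1).eval (q.eval N) {l} →
      (∀ x, x ∈ l ↔ x ∈ s.1 ∧ ∀ y ∈ s.1, ¬ r y x) → l.length ≤ N → HasUndominated r s →
      Spec (α := List (DBFact S) × List (DBFact S))
        (Prog.bind (τ := .prod (.list .fact) (.list .fact))
          (fst (σ := .list .fact) (τ := .list .fact) (var (V := Ty.denote S) s)) fun Io =>
            Prog.bind (snd (σ := .list .fact) (τ := .list .fact) (var (V := Ty.denote S) s)) fun J =>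
              Prog.bind (choose (cand Io)) fun x =>
                pair (remove x Io) (addIfConsistent F x J)).eval
        (p.eval N) (greedyStep F r s) := by
  obtain ⟨p, hp⟩ := spec_addIfConsistent F
  refine ⟨q + X + p + X * (2 * X + 10) + 20, fun N r s cand l hs hcand hl hlN hu => ?_⟩
  have hne : l ≠ [] := by
    obtain ⟨x, hx⟩ := hu
    rintro rfl
    simpa using (hl x).2 hx
  have h1 := spec_fst (S := S) (σ := .list .fact) (τ := .list .fact)
    (spec_var (S := S) (τ := .prod (.list .fact) (.list .fact)) s)
  have h2 := spec_snd_single (S := S) (σ := .list .fact) (τ := .list .fact)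
    (spec_var (S := S) (τ := .prod (.list .fact) (.list .fact)) s)
  have h3 := (spec_choose (S := S) (τ := .fact) hcand hne).mono
    (Nat.add_le_add_left (Nat.add_le_add_left (Nat.add_le_add_left hlN 1) (q.eval N)) 1)
  have h4 := spec_bind (S := S) (τ := .prod (.list .fact) (.list .fact))
    (k := fun x => pair (remove x s.1) (addIfConsistent F x s.2))
    (B := fun x : DBFact S => {((s.1.filter fun y => y ≠ x).reverse, addFact F x s.2)}) h3
    (fun x hx => by
      have hx' := hs.2.1 x ((hl x).1 hx).1
      exact spec_pair (spec_remove hx' hs.fst) (hp N x s.2 hx' hs.snd))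
  have h5 := spec_bind_single (S := S) (k := fun J => Prog.bind (choose (cand s.1)) fun x =>
    pair (remove x s.1) (addIfConsistent F x J)) h2 h4
  have h6 := spec_bind_single (S := S) (σ := .list .fact) (k := fun Io => Prog.bind (snd (σ := .list .fact)
    (τ := .list .fact) (var (V := Ty.denote S) s)) fun J => Prog.bind (choose (cand Io)) fun x =>
      pair (remove x Io) (addIfConsistent F x J)) h1 h5
  refine Spec.congr (Spec.mono h6 ?_) ?_
  · simp only [eval_add, eval_mul, eval_X, eval_ofNat]
    omega
  · ext s'
    constructor
    · rintro ⟨x, hx, rfl⟩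
      exact ⟨x, ((hl x).1 hx).1, ((hl x).1 hx).2, rfl⟩
    · rintro ⟨x, hx, hmax, rfl⟩
      exact ⟨x, (hl x).2 ⟨hx, hmax⟩, rfl⟩

/-- The lists returned by the greedy construction of a repair. -/
def greedyResults (F : List (DenialConstraint S)) (r : DBFact S → DBFact S → Prop)
    (inst : List (DBFact S)) : Set (List (DBFact S)) :=
  {l | ∃ t, Reaches (HasUndominated r) (greedyStep F r) (inst, []) t ∧ l = t.2}

theorem sizeBounded_of_mem_greedyResults {N : ℕ} {inst l : List (DBFact S)}
    (hinst : SizeBounded N inst) (hl : l ∈ greedyResults F r inst) : SizeBounded N l := by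
  obtain ⟨t, ht, rfl⟩ := hl
  exact (StateBounded.of_reaches (N := N) ht hinst.stateBounded).snd

theorem spec_constructRepair (F : List (DenialConstraint S)) : ∃ p : ℕ[X], ∀ (N : ℕ)
    (inst : List (DBFact S)), SizeBounded N inst →
      Spec (α := List (DBFact S)) (constructRepair (S := S) (V := Ty.denote S) F inst).eval
        (p.eval N) (greedyResults F (fun _ _ => False) inst) := by
  -- The candidates are all remaining facts, obtained by reading a variable in one step.
  obtain ⟨p, hp⟩ := spec_round F 1
  refine ⟨(X + 1) * (1 + 5 + p) + 5, fun N inst hinst => ?_⟩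
  have h0 := spec_pair (S := S) (σ := .list .fact) (τ := .list .fact)
    (spec_var (S := S) (τ := .list .fact) inst) (spec_nil (S := S) (τ := .fact))
  have h := spec_snd (S := S) (σ := .list .fact) (τ := .list .fact)
    (spec_whileDo (S := S) (τ := .prod (.list .fact) (.list .fact))
      (C := HasUndominated (S := S) fun _ _ => False) (step := greedyStep F fun _ _ => False)
      (cond := fun s => not (isNil (fst (var s))))
      (body := fun s => bind (fst (var s)) fun Io => bind (snd (var s)) fun J =>
        bind (choose (var Io)) fun x => pair (remove x Io) (addIfConsistent F x J))
      (c := 5) (d := p.eval N)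
      (Inv := StateBounded N) (μ := fun s => List.length s.1) h0 (fun s hs => ?_)
      (fun s hs hC => ?_) (fun s hs _ s' hs' => hs.greedyStep hs') N
      hinst.stateBounded hinst.1)
  · refine Spec.mono h ?_
    simp only [eval_add, eval_mul, eval_X, eval_ofNat, eval_one]
    omega
  · refine ((decides_isNil (spec_fst (S := S) (σ := .list .fact) (τ := .list .fact)
      (spec_var (S := S) (τ := .prod (.list .fact) (.list .fact)) s))).not.mono
        (by omega)).congr (ne_nil_iff_hasUndominated (s := s) (by simp))
  · exact hp N (fun _ _ => False) s (fun l => var (V := Ty.denote S) (τ := .list .fact) l) s.1 hs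
      ((spec_var (S := S) (τ := .list .fact) s.1).mono (by simp)) (by simp) hs.fst.1 hC

theorem spec_winnow {N : ℕ} {prio : List (DBFact S × DBFact S)} {l : List (DBFact S)}
    (hp : PairsSizeBounded N prio) (hl : SizeBounded N l)
    (hprio : ∀ x y, (x, y) ∈ prio ↔ r x y) :
    open Classical in Spec (α := List (DBFact S))
      (winnow (S := S) (V := Ty.denote S) prio l).eval
      (3 + N * (3 + N * (3 + N * (4 * N + 14) + 4) + 2 + 5))
      {(l.filter fun x => decide (∀ y ∈ l, ¬ r y x)).reverse} := by
  classical
  refine (spec_filter (S := S) (τ := .fact) (l := l)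
    (c := 3 + N * (3 + N * (4 * N + 14) + 4) + 2)
    (P := fun x : DBFact S => decide (∀ y ∈ l, ¬ r y x)) fun x hx => ?_).mono
      (Nat.add_le_add_left (Nat.mul_le_mul_right _ hl.1) _)
  have h := decides_existsIn (S := S) (τ := .fact) (l := l) (c := 3 + N * (4 * N + 14))
    (test := fun y => dominates prio y x) (P := fun y : DBFact S => r y x) fun y hy =>
      (decides_dominates hp (hl.2 y hy) (hl.2 x hx)).congr (hprio y x)
  refine (h.not.mono ?_).congr ?_
  · exact Nat.add_le_add_right (Nat.add_le_add_left (Nat.mul_le_mul_right _ hl.1) _) _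
  · rw [decide_eq_true_eq]
    exact ⟨fun h y hy hyx => h ⟨y, hy, hyx⟩, fun h ⟨y, hy, hyx⟩ => h y hy hyx⟩

theorem spec_constructCommonOptimalRepair (F : List (DenialConstraint S)) : ∃ p : ℕ[X], ∀ (N : ℕ)
    (r : DBFact S → DBFact S → Prop) (inst : List (DBFact S)) (prio : List (DBFact S × DBFact S)),
      SizeBounded N inst → PairsSizeBounded N prio → (∀ x y, (x, y) ∈ prio ↔ r x y) →
      Spec (α := List (DBFact S))
        (constructCommonOptimalRepair (S := S) (V := Ty.denote S) F inst prio).eval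
        (p.eval N) (greedyResults F r inst) := by
  classical
  set q : ℕ[X] := 3 + X * (3 + X * (3 + X * (4 * X + 14) + 4) + 2 + 5) with hq
  obtain ⟨p, hp⟩ := spec_round F q
  refine ⟨(X + 1) * (1 + (q + 6) + p) + 5, fun N r inst prio hinst hpb hprio => ?_⟩
  have hqN : q.eval N = 3 + N * (3 + N * (3 + N * (4 * N + 14) + 4) + 2 + 5) := by
    simp [hq]
  have h0 := spec_pair (S := S) (σ := .list .fact) (τ := .list .fact)
    (spec_var (S := S) (τ := .list .fact) inst) (spec_nil (S := S) (τ := .fact))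
  have h := spec_snd (S := S) (σ := .list .fact) (τ := .list .fact)
    (spec_whileDo (S := S) (τ := .prod (.list .fact) (.list .fact))
      (C := HasUndominated r) (step := greedyStep F r)
      (cond := fun s => bind (fst (var s)) fun Io => not (isNil (winnow prio Io)))
      (body := fun s => bind (fst (var s)) fun Io => bind (snd (var s)) fun J =>
        bind (choose (winnow prio Io)) fun x => pair (remove x Io) (addIfConsistent F x J))
      (c := q.eval N + 6) (d := p.eval N)
      (Inv := StateBounded N) (μ := fun s => List.length s.1) h0 (fun s hs => ?_)
      (fun s hs hC => ?_) (fun s hs _ s' hs' => hs.greedyStep hs') N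
      hinst.stateBounded hinst.1)
  · refine Spec.mono h ?_
    simp only [eval_add, eval_mul, eval_X, eval_ofNat, eval_one]
    omega
  · have h1 := spec_bind_single (S := S) (τ := .bool)
      (k := fun Io => not (isNil (winnow prio Io)))
      (spec_fst (S := S) (σ := .list .fact) (τ := .list .fact)
        (spec_var (S := S) (τ := .prod (.list .fact) (.list .fact)) s))
      (decides_isNil (spec_winnow hpb (StateBounded.fst hs) hprio)).not
    exact Decides.congr (Spec.mono h1 (by omega)) (ne_nil_iff_hasUndominated (s := s) fun x =>
      List.mem_reverse.trans (List.mem_filter.trans (and_congr_right fun _ => decide_eq_true_iff)))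
  · refine hp N r s (fun l => winnow prio l) _ hs
      ((spec_winnow hpb (StateBounded.fst hs) hprio).mono hqN.ge) (fun x => ?_) ?_ hC
    · rw [List.mem_reverse]
      exact List.mem_filter.trans (and_congr_right fun _ => decide_eq_true_iff)
    · rw [List.length_reverse]
      exact (List.length_filter_le _ _).trans (StateBounded.fst hs).1

theorem decides_isParetoOptimal (F : List (DenialConstraint S)) : ∃ p : ℕ[X], ∀ (N : ℕ)
    (r : DBFact S → DBFact S → Prop) (inst : List (DBFact S)) (prio : List (DBFact S × DBFact S))
    (inst' : List (DBFact S)), SizeBounded N inst → PairsSizeBounded N prio →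
      (∀ x y, (x, y) ∈ prio ↔ r x y) → SizeBounded N inst' → IsPriority F inst.toFinset r →
      inst'.toFinset ∈ Repairs F inst.toFinset →
      (isParetoOptimal (S := S) (V := Ty.denote S) F inst prio inst').Decides (p.eval N)
        (ParetoOptimal F inst.toFinset r inst'.toFinset) := by
  -- One domination test for each of the `n` facts of the sequence, plus the final negation.
  obtain ⟨p, hp⟩ := decides_existsConflict F fun n =>
    C n * (3 + X * (4 * X + 14) + 2) + 1 + 2
  refine ⟨3 + X * (3 + X * (2 * X + 7) + 2 + (1 + (3 + (p.comp (X + 1) + 2))) + 2 + 4) + 2,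
    fun N r inst prio inst' hinst hpb hprio hinst' hr hrep => ?_⟩
  have h := decides_existsIn (S := S) (τ := .fact) (l := inst)
    (c := 3 + N * (2 * N + 7) + 2 + (1 + (3 + (p.eval (N + 1) + 2))) + 2)
    (test := fun y => and (not (mem y inst')) (bind (cons (var y) (var inst')) fun K =>
      not (existsConflict F K fun fs => not (any (fs.map fun x => dominates prio y x)))))
    (P := fun y : DBFact S => y ∉ inst' ∧
      ¬ ConflictWith F (insert y inst'.toFinset) fun fs => ¬ ∃ x ∈ fs, r y x) fun y hy => ?_
  · refine (h.not.mono ?_).congr ?_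
    · simp only [eval_add, eval_mul, eval_X, eval_ofNat, eval_one, eval_comp]
      exact Nat.add_le_add_right (Nat.add_le_add_left (Nat.mul_le_mul_right _ hinst.1) _) _
    · rw [paretoOptimal_iff hr hrep]
      refine not_congr (exists_congr fun y => ?_)
      exact and_congr (List.mem_toFinset (α := DBFact S)).symm
        (and_congr_left' (not_congr (List.mem_toFinset (α := DBFact S)).symm))
  · have hy' := hinst.2 y hy
    have hpb' : PairsSizeBounded (N + 1) prio :=
      ⟨hpb.1.trans (by omega), fun q hq => ⟨(hpb.2 q hq).1.trans (by omega),
        (hpb.2 q hq).2.trans (by omega)⟩⟩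
    have h1 := spec_bind_single (S := S) (σ := .list .fact) (τ := .bool)
      (k := fun K => not (existsConflict F K fun fs =>
        not (any (fs.map fun x => dominates prio y x))))
      (spec_cons (spec_var (S := S) (τ := .fact) y) (spec_var (S := S) (τ := .list .fact) inst'))
      (hp (N + 1) (y :: inst') (fun fs => not (any (fs.map fun x => dominates prio y x)))
        (fun fs => ¬ ∃ x ∈ fs, r y x) (hinst'.cons hy') fun fs hfs => ?_).not
    · refine ((decides_mem hy' hinst').not.and h1).congr ?_
      exact and_congr_right' (not_congr (iff_of_eq
        (congrArg (fun K => ConflictWith F K _) List.toFinset_cons)))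
    · refine ((decides_any (l := fs) (c := 3 + (N + 1) * (4 * (N + 1) + 14))
        (P := fun x => r y x) fun x hx => (decides_dominates hpb' (by omega)
          ((hinst'.cons hy').2 x (hfs x hx))).congr (hprio y x)).not).mono ?_
      simp

theorem spec_constructParetoOptimalRepair (F : List (DenialConstraint S)) : ∃ p : ℕ[X], ∀ (N : ℕ)
    (r : DBFact S → DBFact S → Prop) (inst : List (DBFact S)) (prio : List (DBFact S × DBFact S)),
      SizeBounded N inst → PairsSizeBounded N prio → (∀ x y, (x, y) ∈ prio ↔ r x y) →
      IsPriority F inst.toFinset r →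
      Spec (α := List (DBFact S))
        (constructParetoOptimalRepair (S := S) (V := Ty.denote S) F inst prio).eval (p.eval N)
        {l | ∃ l' ∈ greedyResults F (fun _ _ => False) inst,
          (ParetoOptimal F inst.toFinset r l'.toFinset ∧ l = l') ∨
            (¬ ParetoOptimal F inst.toFinset r l'.toFinset ∧ l ∈ greedyResults F r inst)} := by
  obtain ⟨p₁, hp₁⟩ := spec_constructRepair F
  obtain ⟨p₂, hp₂⟩ := spec_constructCommonOptimalRepair F
  obtain ⟨p₃, hp₃⟩ := decides_isParetoOptimal F
  refine ⟨1 + (p₁ + (1 + (p₃ + (1 + p₂)))), fun N r inst prio hinst hpb hprio hr => ?_⟩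
  refine (spec_bind (S := S) (σ := .list .fact) (τ := .list .fact)
    (k := fun I' => Prog.ite (isParetoOptimal F inst prio I') (var I')
      (constructCommonOptimalRepair F inst prio))
    (B := fun l' : List (DBFact S) => {l | (ParetoOptimal F inst.toFinset r l'.toFinset ∧ l = l') ∨
      (¬ ParetoOptimal F inst.toFinset r l'.toFinset ∧ l ∈ greedyResults F r inst)})
    (d := 1 + (p₃.eval N + (1 + p₂.eval N))) (hp₁ N inst hinst) fun l' hl' => ?_).mono (by simp)
  -- The test is known to be correct only on repairs, which is what the first phase returns.
  have hrep : List.toFinset (α := DBFact S) l' ∈ Repairs F inst.toFinset := by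
    obtain ⟨t, ht, rfl⟩ := hl'
    have hirr : ∀ x : DBFact S, ¬ Relation.TransGen (fun _ _ => False) x x := by
      intro x hx
      cases hx <;> assumption
    exact greedyRun_iff_mem_repairs.1 (greedyRun_of_reaches hirr ht)
  refine spec_ite (hp₃ N r inst prio l' hinst hpb hprio
    (sizeBounded_of_mem_greedyResults hinst hl') hr hrep) (fun h => ?_) fun h => ?_
  · refine ((spec_var (S := S) (τ := .list .fact) l').mono (by omega)).congr ?_
    ext l
    simp [h]
  · refine ((hp₂ N r inst prio hinst hpb hprio).mono (by omega)).congr ?_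
    ext l
    exact ⟨fun hl => Or.inr ⟨h, hl⟩, fun hl => hl.elim (fun hl => absurd hl.1 h) fun hl => hl.2⟩

end Prog

/-! ### Bounds by the input size, and the final assembly -/

theorem DBFact.one_le_size {S : Schema} (f : DBFact S) : 1 ≤ f.size := by
  unfold DBFact.size
  omega

theorem sizeBounded_inputSize {S : Schema} (inst : List (DBFact S))
    (prio : List (DBFact S × DBFact S)) : SizeBounded (inputSize inst prio) inst := by
  refine ⟨?_, fun f hf => ?_⟩
  · have h : inst.length • 1 ≤ (inst.map DBFact.size).sum := by
      have := List.card_nsmul_le_sum (inst.map DBFact.size) 1 (by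
        intro n hn
        obtain ⟨f, -, rfl⟩ := List.mem_map.1 hn
        exact f.one_le_size)
      simpa using this
    unfold inputSize
    simp only [smul_eq_mul, mul_one] at h
    omega
  · have : f.size ≤ (inst.map DBFact.size).sum :=
      List.single_le_sum (by simp) _ (List.mem_map_of_mem hf)
    unfold inputSize
    omega

theorem pairsSizeBounded_inputSize {S : Schema} (inst : List (DBFact S))
    (prio : List (DBFact S × DBFact S)) : PairsSizeBounded (inputSize inst prio) prio := by
  refine ⟨?_, fun q hq => ?_⟩
  · have h : prio.length • 1 ≤ (prio.map fun q => q.1.size + q.2.size).sum := by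
      have := List.card_nsmul_le_sum (prio.map fun q => q.1.size + q.2.size) 1 (by
        intro n hn
        obtain ⟨q, -, rfl⟩ := List.mem_map.1 hn
        have := q.1.one_le_size
        omega)
      simpa using this
    unfold inputSize
    simp only [smul_eq_mul, mul_one] at h
    omega
  · have : q.1.size + q.2.size ≤ (prio.map fun q => q.1.size + q.2.size).sum :=
      List.single_le_sum (by simp) _ (List.mem_map_of_mem (f := fun q => q.1.size + q.2.size) hq)
    unfold inputSize
    omega

theorem producesExactly_of_spec {S : Schema} {e : Prog S (Ty.denote S) (.list .fact)} {c b : ℕ}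
    {R : Set (List (DBFact S))} {A : Set (DBInstance S)}
    (h : Comp.Spec (α := List (DBFact S)) e.eval c R) (hb : c ≤ b)
    (hA : {J : DBInstance S | ∃ l : List (DBFact S), l ∈ R ∧ l.toFinset = J} = A) :
    ProducesExactly e b A := by
  refine ⟨h.haltsWithin hb, ?_⟩
  rw [← hA, ← h.results_eq hb]
  rfl

theorem mainTheorem12 (S : Schema) (F : List (DenialConstraint S)) :
    ∃ p : Polynomial ℕ, ∀ (I : DBInstance S) (r : DBFact S → DBFact S → Prop), IsPriority F I r →
      ∀ (inst : List (DBFact S)) (prio : List (DBFact S × DBFact S)),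
        inst.toFinset = I → (∀ x y, (x, y) ∈ prio ↔ r x y) →
        ∀ b : ℕ, p.eval (inputSize inst prio) ≤ b →
          -- soundness, completeness and running time of the algorithm
          ProducesExactly (Prog.constructParetoOptimalRepair F inst prio) b (ParetoRepairs F I r) ∧
          -- its parts do what they are said to do: an arbitrary repair is constructed,
          ProducesExactly (Prog.constructRepair F inst) b (Repairs F I) ∧
          -- a repair is tested for Pareto optimality,
          (∀ inst' : List (DBFact S), inst'.Nodup → inst'.toFinset ∈ Repairs F I →
            (Prog.isParetoOptimal F inst prio inst').eval.HaltsWithin b ∧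
            ∀ t : Bool, t ∈ (Prog.isParetoOptimal F inst prio inst').eval.results b ↔
              (t = true ↔ ParetoOptimal F I r inst'.toFinset)) ∧
          -- and otherwise an arbitrary common optimal repair is constructed
          ProducesExactly (Prog.constructCommonOptimalRepair F inst prio) b (CommonRepairs F I r) := by
  obtain ⟨p₁, hp₁⟩ := Prog.spec_constructParetoOptimalRepair F
  obtain ⟨p₂, hp₂⟩ := Prog.spec_constructRepair F
  obtain ⟨p₃, hp₃⟩ := Prog.decides_isParetoOptimal F
  obtain ⟨p₄, hp₄⟩ := Prog.spec_constructCommonOptimalRepair F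
  refine ⟨p₁ + p₂ + p₃ + p₄, fun I r hr inst prio hI hprio b hb => ?_⟩
  subst hI
  simp only [Polynomial.eval_add] at hb
  have hinst := sizeBounded_inputSize inst prio
  have hpb := pairsSizeBounded_inputSize inst prio
  have hirr : ∀ x : DBFact S, ¬ Relation.TransGen (fun _ _ => False) x x := by
    intro x hx
    cases hx <;> assumption
  have hrepairs : {J : DBInstance S | ∃ l : List (DBFact S),
      l ∈ Prog.greedyResults F (fun _ _ => False) inst ∧ l.toFinset = J} =
        Repairs F inst.toFinset :=
    (Prog.image_reaches hirr inst).trans (Set.ext fun _ => greedyRun_iff_mem_repairs)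
  have hcommon : {J : DBInstance S | ∃ l : List (DBFact S),
      l ∈ Prog.greedyResults F r inst ∧ l.toFinset = J} = CommonRepairs F inst.toFinset r :=
    (Prog.image_reaches hr.acyclic inst).trans
      (Set.ext fun _ => greedyRun_iff_mem_commonRepairs hr)
  refine ⟨producesExactly_of_spec (hp₁ _ r inst prio hinst hpb hprio hr) (by omega) ?_,
    producesExactly_of_spec (hp₂ _ inst hinst) (by omega) hrepairs, fun inst' hnd hrep => ?_,
    producesExactly_of_spec (hp₄ _ r inst prio hinst hpb hprio) (by omega) hcommon⟩
  · ext K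
    constructor
    · rintro ⟨l, ⟨l', hl', ⟨hopt, rfl⟩ | ⟨-, hl⟩⟩, rfl⟩
      · exact ⟨hrepairs.subset ⟨l, hl', rfl⟩, hopt⟩
      · have := hcommon.subset ⟨l, hl, rfl⟩
        exact ⟨this.1, this.2.paretoOptimal⟩
    -- Completeness uses the first branch alone: some run of the first phase yields this repair, and
    -- it passes the test.
    · rintro ⟨hK, hopt⟩
      obtain ⟨l, hl, rfl⟩ := hrepairs.superset hK
      exact ⟨l, ⟨l, hl, Or.inl ⟨hopt, rfl⟩⟩, rfl⟩
  · have hsub : ∀ f ∈ inst', f ∈ inst := fun f hf => by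
      simpa using (mem_repairs_iff.1 hrep).1 (List.mem_toFinset.2 hf)
    -- Absence of repetitions is what bounds the length of `inst'` by that of `inst`.
    have hbd : SizeBounded (inputSize inst prio) inst' :=
      ⟨(hnd.subperm hsub).length_le.trans hinst.1, fun f hf => hinst.2 f (hsub f hf)⟩
    have h := hp₃ _ r inst prio inst' hinst hpb hprio hbd hr hrep
    refine ⟨h.haltsWithin (by omega), fun t => ?_⟩
    exact Set.ext_iff.1 (Comp.Spec.results_eq h (b := b) (by omega)) t
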